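/- **Corollary 5.4.** Let $(M^{2m+1},H,J,\theta)$ be a pseudo-Hermitian manifold: $M$ is a (non-empty) smooth manifold of real dimension $2m+1$ with a CR structure given by a rank-$2m$ real distribution $H$ and a complex structure $J$ on $H$ (so $T_{1,0}M=\{X-\sqrt{-1}JX : X\in H\}$ is involutive), and $\theta$ is a nowhere vanishing smooth 1-form with $\ker\theta=H$ whose Levi form $L_\theta(X,Y)=d\theta(X,JY)$ is positive definite on $H$, where $d\theta(X,Y)=\tfrac12\big(X\theta(Y)-Y\theta(X)-\theta([X,Y])\big)$. Let $\xi$ be the Reeb field ($\theta(\xi)=1$, $d\theta(\xi,\cdot)=0$), let $\pi_H$ be the projection of $TM=H\oplus\mathbb R\xi$ onto $H$, let $g_\theta=L_\theta(\pi_H\cdot,\pi_H\cdot)+\theta\otimes\theta$ be the Webster metric with norm $|\cdot|$, let $\nabla^H u$ be the $\pi_H$-component of the $g_\theta$-gradient of $u$, and let $\Delta_b u=\mathrm{trace}_H(\nabla du)$ be the sub-Laplacian, where $\nabla$ is the Tanaka–Webster connection and $(\nabla du)(Y,Z)=Y(Zu)-(\nabla_YZ)u$. Assume that there are a non-negative $C^2$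 function $\gamma$ on $M$, constants $A,B>0$, and a smooth function $G$ on $[0,+\infty)$ such that * for every $\eta>0$ there is a compact set $K_\eta\subset M$ with $\gamma>\eta$ on $M\setminus K_\eta$; * $|\nabla^H\gamma|\le A\,\gamma^{1/2}$ outside some compact subset of $M$; * $\Delta_b\gamma\le B\,\gamma^{1/2}\,G(\gamma^{1/2})^{1/2}$ outside some compact subset of $M$; * $G(0)>0$, $G'\ge 0$ on $[0,+\infty)$, $G^{-1/2}$ is not integrable at $+\infty$, and $\displaystyle\limsup_{t\to+\infty}\frac{t\,G(t^{1/2})}{G(t)}<+\infty$. Let $c_0>0$ and $d\ge 0$ be real constants, and let $u$ be a real-valued $C^2$ function on $M$ with $\Delta_b u\ge c_0u^d$ on $M$ (where $u^0=1$). Then: 1. if $u\ge 0$ and $d>1$, then $u$ vanishes identically; 2. if $0\le u\le\sup_M u<+\infty$ and $0<d\le 1$, then $u$ vanishes identically; 3. if $d=0$, then $u$ is not bounded above; that is, for $d=0$ there is no such function $u$ that is bounded above. -/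

import Mathlib

open Bundle Set Filter Topology MeasureTheory VectorField
open scoped Manifold ContDiff

noncomputable section

namespace PseudoHermitianGeometry

/-- The model space of a real manifold of dimension `2m + 1`. -/
abbrev Model (m : ℕ) : Type := EuclideanSpace ℝ (Fin (2 * m + 1))

section OneForms

variable {m : ℕ} {M : Type*} [TopologicalSpace M] [ChartedSpace (Model m) M]
  [IsManifold 𝓘(ℝ, Model m) ∞ M]

/-- Vector fields on `M` (no regularity assumed). -/
abbrev VecField (m : ℕ) (M : Type*) [TopologicalSpace M] [ChartedSpace (Model m) M] : Type _ :=
  ∀ x : M, TangentSpace 𝓘(ℝ, Model m) x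

/-- The vector field `W` is differentiable at `x`. -/
abbrev DiffAt (W : VecField m M) (x : M) : Prop :=
  MDifferentiableAt 𝓘(ℝ, Model m) 𝓘(ℝ, Model m).tangent
    (fun y => (⟨y, W y⟩ : TangentBundle 𝓘(ℝ, Model m) M)) x

/-- A field of covectors is a smooth 1-form: it is smooth as a function on the total space of the
tangent bundle. -/
def SmoothOneForm (θ : ∀ x : M, TangentSpace 𝓘(ℝ, Model m) x →L[ℝ] ℝ) : Prop :=
  ContMDiff 𝓘(ℝ, Model m).tangent 𝓘(ℝ) ∞
    (fun v : TangentBundle 𝓘(ℝ, Model m) M => θ v.1 v.2)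

/-- The formula `dθ(V, W) = (1/2) (V(θ(W)) - W(θ(V)) - θ([V, W]))` for vector fields. The factor `1/2`
is the normalization of `dθ` for which the Tanaka-Webster torsion is
`T(X, Y) = 2 dθ(X, Y) ξ` on horizontal vectors. -/
def cartanFormula (θ : ∀ x : M, TangentSpace 𝓘(ℝ, Model m) x →L[ℝ] ℝ) (x : M) (V W : VecField m M) : ℝ :=
  (1 / 2) * (mvfderiv 𝓘(ℝ, Model m) (fun y => θ y (W y)) x (V x)
    - mvfderiv 𝓘(ℝ, Model m) (fun y => θ y (V y)) x (W x)
    - θ x (mlieBracket 𝓘(ℝ, Model m) V W x))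

lemma SmoothOneForm.mdiffAt {θ : ∀ x : M, TangentSpace 𝓘(ℝ, Model m) x →L[ℝ] ℝ} (hθ : SmoothOneForm θ) {x : M}
    {W : VecField m M} (hW : DiffAt W x) : MDifferentiableAt 𝓘(ℝ, Model m) 𝓘(ℝ) (fun y => θ y (W y)) x :=
  MDifferentiableAt.comp (g := fun v : TangentBundle 𝓘(ℝ, Model m) M => θ v.1 v.2) x
    ((hθ _).mdifferentiableAt (by simp)) hW

lemma cartan_swap (θ : ∀ x : M, TangentSpace 𝓘(ℝ, Model m) x →L[ℝ] ℝ) (x : M) (V W : VecField m M) :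
    cartanFormula θ x V W = - cartanFormula θ x W V := by
  simp only [cartanFormula, mlieBracket_swap_apply (V := V) (W := W), map_neg]
  ring

lemma tensorial_cartan {θ : ∀ x : M, TangentSpace 𝓘(ℝ, Model m) x →L[ℝ] ℝ} (hθ : SmoothOneForm θ) (x : M)
    (W : VecField m M) (_ : DiffAt W x) :
    TensorialAt 𝓘(ℝ, Model m) (Model m) (cartanFormula θ x · W) x where
  smul {f V} hf hV := by
    have h1 : (fun y => θ y ((f • V) y)) = f * (fun y => θ y (V y)) := by
      ext y; simp
    simp only [cartanFormula, mlieBracket_smul_left hf hV, h1,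
      mvfderiv_mul hf (hθ.mdiffAt hV)]
    simp
    ring
  add {V V'} hV hV' := by
    have h1 : (fun y => θ y ((V + V') y)) = (fun y => θ y (V y)) + (fun y => θ y (V' y)) := by
      ext y; simp
    simp only [cartanFormula, mlieBracket_add_left hV hV', h1,
      mvfderiv_add (hθ.mdiffAt hV) (hθ.mdiffAt hV')]
    simp
    ring

lemma tensorial_cartan' {θ : ∀ x : M, TangentSpace 𝓘(ℝ, Model m) x →L[ℝ] ℝ} (hθ : SmoothOneForm θ) (x : M)
    (V : VecField m M) (hV : DiffAt V x) :
    TensorialAt 𝓘(ℝ, Model m) (Model m) (cartanFormula θ x V ·) x where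
  smul {f W} hf hW := by
    have := (tensorial_cartan hθ x V hV).smul hf hW
    rw [cartan_swap, cartan_swap θ x V W, this, smul_neg]
  add {W W'} hW hW' := by
    have := (tensorial_cartan hθ x V hV).add hW hW'
    rw [cartan_swap, cartan_swap θ x V W, cartan_swap θ x V W', this]; ring

/-- The exterior derivative of a smooth 1-form, as a bilinear form on each tangent space. -/
def dForm {θ : ∀ x : M, TangentSpace 𝓘(ℝ, Model m) x →L[ℝ] ℝ} (hθ : SmoothOneForm θ) (x : M) :
    TangentSpace 𝓘(ℝ, Model m) x →L[ℝ] TangentSpace 𝓘(ℝ, Model m) x →L[ℝ] ℝ :=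
  TensorialAt.mkHom₂ (cartanFormula θ x) x (tensorial_cartan hθ x) (tensorial_cartan' hθ x)

lemma dForm_apply {θ : ∀ x : M, TangentSpace 𝓘(ℝ, Model m) x →L[ℝ] ℝ} (hθ : SmoothOneForm θ) {x : M}
    {V W : VecField m M} (hV : DiffAt V x) (hW : DiffAt W x) :
    dForm hθ x (V x) (W x) = cartanFormula θ x V W :=
  TensorialAt.mkHom₂_apply _ _ hV hW

lemma dForm_swap {θ : ∀ x : M, TangentSpace 𝓘(ℝ, Model m) x →L[ℝ] ℝ} (hθ : SmoothOneForm θ) (x : M)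
    (v w : TangentSpace 𝓘(ℝ, Model m) x) : dForm hθ x v w = - dForm hθ x w v := by
  simp only [dForm, TensorialAt.mkHom₂_apply_eq_extend]
  exact cartan_swap _ _ _ _

/-- The vector field `W` is smooth on the open set `U`. -/
abbrev SmoothOn (W : VecField m M) (U : Set M) : Prop :=
  ContMDiffOn 𝓘(ℝ, Model m) 𝓘(ℝ, Model m).tangent ∞
    (fun y => (⟨y, W y⟩ : TangentBundle 𝓘(ℝ, Model m) M)) U

end OneForms

/-- A CR structure `(H, J)` on a manifold of dimension `2m + 1`: a smooth real distribution `H` of rank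
`2m` with a smooth complex structure `J` on it. The corresponding complex subbundle of `TM ⊗ ℂ`, of
complex rank `m`, is `T_{1,0} = {X - i J X : X ∈ H}`, so that `T_{1,0} ∩ conj T_{1,0} = 0`,
`H = Re (T_{1,0} ⊕ T_{0,1})` and `J (Z + conj Z) = i (Z - conj Z)` for `Z ∈ T_{1,0}`; it has to be
involutive. -/
structure CRStructure (m : ℕ) (M : Type*) [TopologicalSpace M] [ChartedSpace (Model m) M]
    [IsManifold 𝓘(ℝ, Model m) ∞ M] where
  /-- the Levi distribution -/
  H : ∀ x : M, Submodule ℝ (TangentSpace 𝓘(ℝ, Model m) x)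
  /-- near every point, `H` has a smooth frame of `2m` vector fields -/
  exists_frame : ∀ x : M, ∃ U : Set M, IsOpen U ∧ x ∈ U ∧ ∃ X : Fin (2 * m) → ∀ y : M, H y,
    (∀ i, SmoothOn (fun y => (X i y : TangentSpace 𝓘(ℝ, Model m) y)) U) ∧
    ∀ y ∈ U, LinearIndependent ℝ (fun i => X i y) ∧ Submodule.span ℝ (range fun i => X i y) = ⊤
  /-- the complex structure of `H` -/
  J : ∀ x : M, H x →ₗ[ℝ] H x
  J_sq : ∀ (x : M) (v : H x), J x (J x v) = -v
  /-- `J` maps smooth local sections of `H` to smooth local sections -/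
  J_smooth : ∀ (U : Set M) (X : ∀ y : M, H y), IsOpen U →
    SmoothOn (fun y => (X y : TangentSpace 𝓘(ℝ, Model m) y)) U →
    SmoothOn (fun y => (J y (X y) : TangentSpace 𝓘(ℝ, Model m) y)) U
  /-- `[Γ(T_{1,0}), Γ(T_{1,0})] ⊆ Γ(T_{1,0})`: every section of `T_{1,0}` is `X - i J X` for a section
  `X` of `H`, and
  `[X - i J X, Y - i J Y] = ([X, Y] - [J X, J Y]) - i ([X, J Y] + [J X, Y])`
  has to be of the form `Z - i J Z` with `Z ∈ H`. -/
  involutive : ∀ (U : Set M) (X Y : ∀ y : M, H y), IsOpen U →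
    SmoothOn (fun y => (X y : TangentSpace 𝓘(ℝ, Model m) y)) U →
    SmoothOn (fun y => (Y y : TangentSpace 𝓘(ℝ, Model m) y)) U →
    ∀ x ∈ U, ∃ Z : H x,
      (Z : TangentSpace 𝓘(ℝ, Model m) x) =
        mlieBracket 𝓘(ℝ, Model m) (fun y => (X y : TangentSpace 𝓘(ℝ, Model m) y)) (fun y => Y y) x
        - mlieBracket 𝓘(ℝ, Model m) (fun y => (J y (X y) : TangentSpace 𝓘(ℝ, Model m) y))
            (fun y => J y (Y y)) x ∧
      (J x Z : TangentSpace 𝓘(ℝ, Model m) x) =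
        mlieBracket 𝓘(ℝ, Model m) (fun y => (X y : TangentSpace 𝓘(ℝ, Model m) y))
            (fun y => J y (Y y)) x
        + mlieBracket 𝓘(ℝ, Model m) (fun y => (J y (X y) : TangentSpace 𝓘(ℝ, Model m) y))
            (fun y => Y y) x

/-- A pseudo-Hermitian structure on `M`: a CR structure `(H, J)` and a nowhere vanishing smooth 1-form
`θ` with `ker θ = H` whose Levi form `L_θ(X, Y) = dθ(X, J Y)` is positive definite on `H`. -/
structure PseudoHermitian (m : ℕ) (M : Type*) [TopologicalSpace M] [ChartedSpace (Model m) M]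
    [IsManifold 𝓘(ℝ, Model m) ∞ M] extends CRStructure m M where
  θ : ∀ x : M, TangentSpace 𝓘(ℝ, Model m) x →L[ℝ] ℝ
  θ_smooth : SmoothOneForm θ
  θ_ne_zero : ∀ x, θ x ≠ 0
  mem_H_iff : ∀ (x : M) (v : TangentSpace 𝓘(ℝ, Model m) x), v ∈ H x ↔ θ x v = 0
  levi_pos : ∀ (x : M) (v : H x), v ≠ 0 → 0 < dForm θ_smooth x v (J x v)

namespace PseudoHermitian

variable {m : ℕ} {M : Type*} [TopologicalSpace M] [ChartedSpace (Model m) M]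
  [IsManifold 𝓘(ℝ, Model m) ∞ M] (S : PseudoHermitian m M)

/-- The exterior derivative of `θ`. -/
def dθ (x : M) : TangentSpace 𝓘(ℝ, Model m) x →L[ℝ] TangentSpace 𝓘(ℝ, Model m) x →L[ℝ] ℝ :=
  dForm S.θ_smooth x

/-- The Levi form `L_θ(v, w) = dθ(v, J w)` on `H`. -/
def levi (x : M) : LinearMap.BilinForm ℝ (S.H x) :=
  LinearMap.mk₂ ℝ (fun v w => S.dθ x v (S.J x w)) (by simp) (by simp) (by simp) (by simp)

lemma levi_apply (x : M) (v w : S.H x) : S.levi x v w = S.dθ x v (S.J x w) := rfl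

lemma finrank_H (x : M) : Module.finrank ℝ (S.H x) = 2 * m := by
  obtain ⟨U, -, hx, X, -, hX⟩ := S.exists_frame x
  have := Module.finrank_eq_card_basis (Module.Basis.mk (hX x hx).1 (hX x hx).2.ge)
  simpa using this

instance (x : M) : FiniteDimensional ℝ (S.H x) := by
  obtain ⟨U, -, hx, X, -, hX⟩ := S.exists_frame x
  exact (Module.Basis.mk (hX x hx).1 (hX x hx).2.ge).finiteDimensional_of_finite

/-- Every horizontal vector extends to a horizontal field that is smooth near its base point. -/
lemma exists_extension (x : M) (v : S.H x) : ∃ (U : Set M) (X : ∀ y, S.H y), IsOpen U ∧ x ∈ U ∧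
    SmoothOn (fun y => (X y : TangentSpace 𝓘(ℝ, Model m) y)) U ∧ X x = v := by
  obtain ⟨U, hU, hx, X, hs, hX⟩ := S.exists_frame x
  let b := Module.Basis.mk (hX x hx).1 (hX x hx).2.ge
  refine ⟨U, fun y => ∑ i, b.repr v i • X i y, hU, hx, ?_, ?_⟩
  · have : ContMDiffOn 𝓘(ℝ, Model m) 𝓘(ℝ, Model m).tangent ∞ (fun y =>
        (⟨y, ∑ i, b.repr v i • (X i y : TangentSpace 𝓘(ℝ, Model m) y)⟩ :
          TangentBundle 𝓘(ℝ, Model m) M)) U :=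
      ContMDiffOn.sum_section fun i _ => ContMDiffOn.const_smul_section (hs i)
    convert this using 3
    simp
  · conv_rhs => rw [← b.sum_repr v]
    simp [b]

lemma dθ_horizontal {x : M} {U : Set M} (hU : IsOpen U) (hx : x ∈ U) (X Y : ∀ y, S.H y)
    (hX : SmoothOn (fun y => (X y : TangentSpace 𝓘(ℝ, Model m) y)) U)
    (hY : SmoothOn (fun y => (Y y : TangentSpace 𝓘(ℝ, Model m) y)) U) :
    S.dθ x (X x) (Y x) = - (1 / 2) * S.θ x (mlieBracket 𝓘(ℝ, Model m)
      (fun y => (X y : TangentSpace 𝓘(ℝ, Model m) y)) (fun y => Y y) x) := by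
  have h0 : ∀ Z : ∀ y, S.H y, (fun y => S.θ y (Z y)) = fun _ => 0 := fun Z => by
    ext y; exact (S.mem_H_iff y _).1 (Z y).2
  have hX' := ((hX x hx).contMDiffAt (hU.mem_nhds hx)).mdifferentiableAt (by simp)
  have hY' := ((hY x hx).contMDiffAt (hU.mem_nhds hx)).mdifferentiableAt (by simp)
  have := dForm_apply S.θ_smooth hX' hY'
  rw [dθ, this, cartanFormula, h0, h0, mvfderiv_const]
  simp

lemma levi_symm (x : M) (v w : S.H x) : S.levi x v w = S.levi x w v := by
  have key : ∀ v w : S.H x, S.dθ x (S.J x v) (S.J x w) = S.dθ x v w := by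
    intro v w
    obtain ⟨U, X, hU, hxU, hX, rfl⟩ := S.exists_extension x v
    obtain ⟨U', Y, hU', hxU', hY, rfl⟩ := S.exists_extension x w
    have hX := hX.mono (inter_subset_left (t := U'))
    have hY := hY.mono (inter_subset_right (s := U))
    have hO := hU.inter hU'
    have hx : x ∈ U ∩ U' := ⟨hxU, hxU'⟩
    obtain ⟨Z, hZ, -⟩ := S.involutive _ X Y hO hX hY x hx
    rw [S.dθ_horizontal hO hx X Y hX hY, S.dθ_horizontal hO hx (fun y => S.J y (X y))
      (fun y => S.J y (Y y)) (S.J_smooth _ _ hO hX) (S.J_smooth _ _ hO hY)]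
    have := (S.mem_H_iff x _).1 Z.2
    rw [hZ, map_sub] at this
    linarith
  rw [levi_apply, levi_apply, ← key, S.J_sq, dθ, dForm_swap]
  simp

/-- `H` has orthonormal bases at `x` for the Levi form. -/
lemma exists_orthonormalFrame (x : M) : ∃ e : Fin (2 * m) → S.H x,
    ∀ i j, S.levi x (e i) (e j) = if i = j then 1 else 0 := by
  obtain ⟨b, hb⟩ := LinearMap.BilinForm.exists_orthogonal_basis
    (B := S.levi x) ⟨fun v w => S.levi_symm x v w⟩
  have hpos : ∀ i, 0 < S.levi x (b i) (b i) := fun i => S.levi_pos x _ (b.ne_zero i)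
  have h : ∃ e : Fin (Module.finrank ℝ (S.H x)) → S.H x,
      ∀ i j, S.levi x (e i) (e j) = if i = j then 1 else 0 := by
    refine ⟨fun i => (√(S.levi x (b i) (b i)))⁻¹ • b i, fun i j => ?_⟩
    simp only [map_smul, LinearMap.smul_apply, smul_eq_mul]
    split_ifs with hij
    · subst hij
      have h1 := Real.mul_self_sqrt (hpos i).le
      have h2 := Real.sqrt_pos.2 (hpos i)
      field_simp
      nlinarith
    · rw [show S.levi x (b i) (b j) = 0 from hb hij]; simp
  rwa [S.finrank_H x] at h

/-- An orthonormal basis of `H` at `x` for the Levi form. -/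
def frame (x : M) : Fin (2 * m) → S.H x := (S.exists_orthonormalFrame x).choose

lemma exists_reeb (x : M) : ∃ ξ : TangentSpace 𝓘(ℝ, Model m) x,
    S.θ x ξ = 1 ∧ ∀ w, S.dθ x ξ w = 0 := by
  obtain ⟨t, ht⟩ : ∃ t, S.θ x t = 1 := by
    obtain ⟨v, hv⟩ := DFunLike.ne_iff.1 (S.θ_ne_zero x)
    exact ⟨(S.θ x v)⁻¹ • v, by simpa using inv_mul_cancel₀ hv⟩
  let Φ : S.H x →ₗ[ℝ] Module.Dual ℝ (S.H x) :=
    LinearMap.mk₂ ℝ (fun v w => S.dθ x v w) (by simp) (by simp) (by simp) (by simp)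
  have hinj : Function.Injective Φ := by
    rw [injective_iff_map_eq_zero]
    intro v hv
    by_contra hne
    have h1 := S.levi_pos x v hne
    have h2 : Φ v (S.J x v) = 0 := by rw [hv]; rfl
    exact h1.ne' h2
  have hsurj := (LinearMap.injective_iff_surjective_of_finrank_eq_finrank
    (Subspace.dual_finrank_eq (K := ℝ) (V := S.H x)).symm).1 hinj
  obtain ⟨h, hh⟩ := hsurj (((S.dθ x t : TangentSpace 𝓘(ℝ, Model m) x →L[ℝ] ℝ) :
    TangentSpace 𝓘(ℝ, Model m) x →ₗ[ℝ] ℝ).domRestrict (S.H x))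
  have hH : ∀ w : S.H x, S.dθ x (t - h) w = 0 := fun w => by
    have : S.dθ x h w = S.dθ x t w := LinearMap.congr_fun hh w
    simp [this]
  have hθh : S.θ x h = 0 := (S.mem_H_iff x _).1 h.2
  have hself : S.dθ x (t - h) (t - h) = 0 := by
    have := dForm_swap S.θ_smooth x (t - h) (t - h)
    simp only [dθ]; linarith
  have hone : S.θ x (t - h) = 1 := by simp [ht, hθh]
  refine ⟨t - h, hone, fun w => ?_⟩
  have hw : w - S.θ x w • (t - (h : TangentSpace 𝓘(ℝ, Model m) x)) ∈ S.H x := by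
    rw [S.mem_H_iff, map_sub, map_smul, hone]; simp
  have := hH ⟨_, hw⟩
  rw [map_sub, map_smul, hself] at this
  simpa using this

/-- The Reeb vector field `ξ`: `θ(ξ) = 1` and `dθ(ξ, ·) = 0`. -/
def reeb : VecField m M := fun x => (S.exists_reeb x).choose

lemma θ_reeb (x : M) : S.θ x (S.reeb x) = 1 := (S.exists_reeb x).choose_spec.1

lemma dθ_reeb (x : M) (w : TangentSpace 𝓘(ℝ, Model m) x) : S.dθ x (S.reeb x) w = 0 :=
  (S.exists_reeb x).choose_spec.2 w

/-- The projection of `TM = H ⊕ ℝ ξ` onto `H`. -/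
def πH (x : M) : TangentSpace 𝓘(ℝ, Model m) x →ₗ[ℝ] S.H x where
  toFun v := ⟨v - S.θ x v • S.reeb x, by rw [S.mem_H_iff]; simp [S.θ_reeb]⟩
  map_add' v w := by ext; simp [add_smul]; abel
  map_smul' c v := by ext; simp [mul_smul, smul_sub]

/-- `J`, extended to `TM` by `J ξ = 0`. -/
def Jext (x : M) : TangentSpace 𝓘(ℝ, Model m) x →ₗ[ℝ] TangentSpace 𝓘(ℝ, Model m) x :=
  (S.H x).subtype ∘ₗ S.J x ∘ₗ S.πH x

/-- `G_θ(v, w) = L_θ(π_H v, π_H w)`. -/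
def Gθ (x : M) (v w : TangentSpace 𝓘(ℝ, Model m) x) : ℝ := S.levi x (S.πH x v) (S.πH x w)

/-- The Webster metric `g_θ = G_θ + θ ⊗ θ`. -/
def webster (x : M) (v w : TangentSpace 𝓘(ℝ, Model m) x) : ℝ := S.Gθ x v w + S.θ x v * S.θ x w

/-- The derivative `V f` of a function along a vector field. -/
def lie (V : VecField m M) (f : M → ℝ) (x : M) : ℝ := mvfderiv 𝓘(ℝ, Model m) f x (V x)

/-- The right-hand side of the Koszul formula. For horizontal `X, Y, Z` it is `2 G_θ(∇_X Y, Z)`, where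
`∇` is the Tanaka-Webster connection, because `∇` is metric, preserves `H`, and has
`T(X, Y) = 2 dθ(X, Y) ξ`. -/
def koszul (X Y Z : VecField m M) (x : M) : ℝ :=
  lie X (fun y => S.Gθ y (Y y) (Z y)) x + lie Y (fun y => S.Gθ y (X y) (Z y)) x
    - lie Z (fun y => S.Gθ y (X y) (Y y)) x
    + S.Gθ x (mlieBracket 𝓘(ℝ, Model m) X Y x) (Z x)
    - S.Gθ x (mlieBracket 𝓘(ℝ, Model m) X Z x) (Y x)
    - S.Gθ x (mlieBracket 𝓘(ℝ, Model m) Y Z x) (X x)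

/-- The horizontal part `π_H W` of a vector field. -/
def horizontalPart (W : VecField m M) : VecField m M := fun y => S.πH y (W y)

/-- The Tanaka-Webster connection, `tanakaWebster S Y x v = (∇_v Y)(x)`. It is the connection given by
* `∇_X Y` for `X, Y` in `H` is the vector of `H` determined by the Koszul formula,
* `∇_ξ Y = (1/2) (π_H [ξ, Y] - J [ξ, J Y])` for `Y` in `H`,
* `∇ ξ = 0`;
a general `Y` is decomposed as `π_H Y + θ(Y) ξ`, and a general `v` as `π_H v + θ(v) ξ`.
See `IsTanakaWebster.eq_tanakaWebster` for the agreement with the axioms of this connection. -/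
def tanakaWebster (Y : VecField m M) (x : M) (v : TangentSpace 𝓘(ℝ, Model m) x) :
    TangentSpace 𝓘(ℝ, Model m) x :=
  let YH := S.horizontalPart Y
  let ext (w : TangentSpace 𝓘(ℝ, Model m) x) : VecField m M :=
    S.horizontalPart (FiberBundle.extend (Model m) w)
  (∑ i, ((1 / 2) * S.koszul (ext v) YH (ext (S.frame x i)) x) •
      (S.frame x i : TangentSpace 𝓘(ℝ, Model m) x))
    + (S.θ x v / 2) • ((S.πH x (mlieBracket 𝓘(ℝ, Model m) S.reeb YH x) :
          TangentSpace 𝓘(ℝ, Model m) x)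
        - S.Jext x (mlieBracket 𝓘(ℝ, Model m) S.reeb (fun y => S.Jext y (Y y)) x))
    + mvfderiv 𝓘(ℝ, Model m) (fun y => S.θ y (Y y)) x v • S.reeb x

/-- The Hessian `(∇du)(v, w) = v(W u) - (∇_v W) u` for the Tanaka-Webster connection, where `W` is a
vector field extending `w`, smooth near `x`. -/
def hessian (u : M → ℝ) (x : M) (v w : TangentSpace 𝓘(ℝ, Model m) x) : ℝ :=
  mvfderiv 𝓘(ℝ, Model m)
      (fun y => mvfderiv 𝓘(ℝ, Model m) u y (FiberBundle.extend (Model m) w y)) x v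
    - mvfderiv 𝓘(ℝ, Model m) u x (S.tanakaWebster (FiberBundle.extend (Model m) w) x v)

/-- The sub-Laplacian `Δ_b u = trace_H (∇du)`. -/
def subLaplacian (u : M → ℝ) (x : M) : ℝ := ∑ i, S.hessian u x (S.frame x i) (S.frame x i)

/-- The gradient of `u` for the Webster metric, in the orthonormal basis `e_1, …, e_{2m}, ξ`. -/
def gradient (u : M → ℝ) : VecField m M := fun x =>
  (∑ i, mvfderiv 𝓘(ℝ, Model m) u x (S.frame x i) • (S.frame x i : TangentSpace 𝓘(ℝ, Model m) x))
    + mvfderiv 𝓘(ℝ, Model m) u x (S.reeb x) • S.reeb x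

/-- The horizontal gradient `∇^H u = π_H (∇u)`. -/
def horizontalGradient (u : M → ℝ) : VecField m M := S.horizontalPart (S.gradient u)

/-- The norm of the Webster metric. -/
def websterNorm (x : M) (v : TangentSpace 𝓘(ℝ, Model m) x) : ℝ := √(S.webster x v v)

/-- The axioms of the Tanaka-Webster connection: it preserves `H`, `∇J = 0`, `∇g_θ = 0`,
`T(X, Y) = 2 dθ(X, Y) ξ` for `X, Y` in `H`, and `T(ξ, J X) + J T(ξ, X) = 0`. (In Mathlib, `cov Y x v`
is `(∇_v Y)(x)`.) This predicate only serves to check the explicit definition `tanakaWebster`. -/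
structure IsTanakaWebster
    (cov : CovariantDerivative 𝓘(ℝ, Model m) (Model m)
      (fun x : M => TangentSpace 𝓘(ℝ, Model m) x)) : Prop where
  preserves_H : ∀ (x : M) (v : TangentSpace 𝓘(ℝ, Model m) x) (Y : ∀ y, S.H y),
    DiffAt (fun y => (Y y : TangentSpace 𝓘(ℝ, Model m) y)) x → cov (fun y => Y y) x v ∈ S.H x
  J_parallel : ∀ (x : M) (v : TangentSpace 𝓘(ℝ, Model m) x) (Y : VecField m M), DiffAt Y x →
    cov (fun y => S.Jext y (Y y)) x v = S.Jext x (cov Y x v)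
  metric : ∀ (x : M) (v : TangentSpace 𝓘(ℝ, Model m) x) (Y Z : VecField m M),
    DiffAt Y x → DiffAt Z x →
    mvfderiv 𝓘(ℝ, Model m) (fun y => S.webster y (Y y) (Z y)) x v =
      S.webster x (cov Y x v) (Z x) + S.webster x (Y x) (cov Z x v)
  torsion_H : ∀ (x : M) (v w : S.H x), cov.torsion x v w = (2 * S.dθ x v w) • S.reeb x
  torsion_reeb : ∀ (x : M) (v : TangentSpace 𝓘(ℝ, Model m) x),
    cov.torsion x (S.reeb x) (S.Jext x v) + S.Jext x (cov.torsion x (S.reeb x) v) = 0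

lemma levi_frame (x : M) (i j : Fin (2 * m)) :
    S.levi x (S.frame x i) (S.frame x j) = if i = j then 1 else 0 :=
  (S.exists_orthonormalFrame x).choose_spec i j

lemma sum_frame (x : M) (v : S.H x) :
    ∑ i, S.levi x v (S.frame x i) • S.frame x i = v := by
  have hli : LinearIndependent ℝ (S.frame x) := by
    rw [Fintype.linearIndependent_iff]
    intro c hc j
    have := congrArg (fun w => S.levi x w (S.frame x j)) hc
    simpa [S.levi_frame] using this
  have hspan : v ∈ Submodule.span ℝ (range (S.frame x)) := by
    rw [hli.span_eq_top_of_card_eq_finrank' (by simp [S.finrank_H])]; trivial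
  obtain ⟨c, rfl⟩ := (Submodule.mem_span_range_iff_exists_fun ℝ).1 hspan
  simp [S.levi_frame]

lemma πH_coe (x : M) (v : S.H x) : S.πH x v = v := by
  ext; simp [πH, (S.mem_H_iff x _).1 v.2]

lemma πH_reeb (x : M) : S.πH x (S.reeb x) = 0 := by
  ext; simp [πH, S.θ_reeb]

lemma θ_coe (x : M) (v : S.H x) : S.θ x v = 0 := (S.mem_H_iff x _).1 v.2

lemma horizontal_diffAt {x : M} {W : VecField m M} (hW : DiffAt W x) (hξ : DiffAt S.reeb x) :
    DiffAt (S.horizontalPart W) x :=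
  mdifferentiableAt_sub_section hW ((S.θ_smooth.mdiffAt hW).smul_section hξ)

lemma IsTanakaWebster.koszul_eq {cov : CovariantDerivative 𝓘(ℝ, Model m) (Model m)
      (fun x : M => TangentSpace 𝓘(ℝ, Model m) x)} (h : S.IsTanakaWebster cov) {x : M}
    (X Y Z : ∀ y, S.H y) (hX : DiffAt (fun y => (X y : TangentSpace 𝓘(ℝ, Model m) y)) x)
    (hY : DiffAt (fun y => (Y y : TangentSpace 𝓘(ℝ, Model m) y)) x)
    (hZ : DiffAt (fun y => (Z y : TangentSpace 𝓘(ℝ, Model m) y)) x) :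
    S.koszul (fun y => X y) (fun y => Y y) (fun y => Z y) x =
      2 * S.levi x (S.πH x (cov (fun y => Y y) x (X x))) (Z x) := by
  have metric : ∀ V Y Z : ∀ y, S.H y, DiffAt (fun y => (Y y : TangentSpace 𝓘(ℝ, Model m) y)) x →
      DiffAt (fun y => (Z y : TangentSpace 𝓘(ℝ, Model m) y)) x →
      lie (fun y => (V y : TangentSpace 𝓘(ℝ, Model m) y)) (fun y => S.Gθ y (Y y) (Z y)) x =
        S.levi x (S.πH x (cov (fun y => Y y) x (V x))) (Z x)
        + S.levi x (S.πH x (cov (fun y => Z y) x (V x))) (Y x) := by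
    intro V Y Z hY hZ
    have := h.metric x (V x) _ _ hY hZ
    simp only [webster, S.θ_coe, mul_zero, zero_mul, add_zero] at this
    rw [lie, this, Gθ, Gθ, S.πH_coe, S.πH_coe, S.levi_symm x (Y x)]
  have tors : ∀ X Y Z : ∀ y, S.H y, DiffAt (fun y => (X y : TangentSpace 𝓘(ℝ, Model m) y)) x →
      DiffAt (fun y => (Y y : TangentSpace 𝓘(ℝ, Model m) y)) x →
      S.Gθ x (mlieBracket 𝓘(ℝ, Model m) (fun y => (X y : TangentSpace 𝓘(ℝ, Model m) y))
        (fun y => Y y) x) (Z x) =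
        S.levi x (S.πH x (cov (fun y => Y y) x (X x))) (Z x)
        - S.levi x (S.πH x (cov (fun y => X y) x (Y x))) (Z x) := by
    intro X Y Z hX hY
    have h1 := cov.torsion_apply hX hY
    rw [h.torsion_H] at h1
    have h2 := congrArg (S.πH x) (sub_eq_iff_eq_add.1 h1.symm)
    simp only [map_sub, map_add, map_smul, S.πH_reeb, smul_zero, zero_add] at h2
    rw [Gθ, ← h2, S.πH_coe]
    simp
  rw [koszul, metric X Y Z hY hZ, metric Y X Z hX hZ, metric Z X Y hX hY, tors X Y Z hX hY,
    tors X Z Y hX hZ, tors Y Z X hY hZ]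
  ring

/-- A connection that satisfies the axioms of the Tanaka-Webster connection is the one defined above. -/
theorem IsTanakaWebster.eq_tanakaWebster {cov : CovariantDerivative 𝓘(ℝ, Model m) (Model m)
      (fun x : M => TangentSpace 𝓘(ℝ, Model m) x)} (h : S.IsTanakaWebster cov)
    (hξ : SmoothOn S.reeb univ) {x : M} (Y : VecField m M) {U : Set M} (hU : IsOpen U)
    (hx : x ∈ U) (hY : SmoothOn Y U) (v : TangentSpace 𝓘(ℝ, Model m) x) :
    cov Y x v = S.tanakaWebster Y x v := by
  have hξx : DiffAt S.reeb x :=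
    ((hξ x trivial).contMDiffAt univ_mem).mdifferentiableAt (by simp)
  have hYx : DiffAt Y x := ((hY x hx).contMDiffAt (hU.mem_nhds hx)).mdifferentiableAt (by simp)
  have hYH : DiffAt (S.horizontalPart Y) x := S.horizontal_diffAt hYx hξx
  have hJY : DiffAt (fun y => S.Jext y (Y y)) x := by
    have hθY : ContMDiffOn 𝓘(ℝ, Model m) 𝓘(ℝ) ∞ (fun y => S.θ y (Y y)) U :=
      ContMDiff.comp_contMDiffOn (g := fun v : TangentBundle 𝓘(ℝ, Model m) M => S.θ v.1 v.2)
        S.θ_smooth hY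
    have h1 : SmoothOn (S.horizontalPart Y) U :=
      ContMDiffOn.sub_section hY (hθY.smul_section (hξ.mono (subset_univ _)))
    have h2 := S.J_smooth U (fun y => S.πH y (Y y)) hU h1
    exact ((h2 x hx).contMDiffAt (hU.mem_nhds hx)).mdifferentiableAt (by simp)
  have hext : ∀ w : TangentSpace 𝓘(ℝ, Model m) x,
      DiffAt (S.horizontalPart (FiberBundle.extend (Model m) w)) x := fun w =>
    S.horizontal_diffAt (FiberBundle.mdifferentiableAt_extend ..) hξx
  -- the Reeb field is parallel
  have hpar : ∀ v, cov S.reeb x v = 0 := by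
    intro v
    have hθ0 : S.θ x (cov S.reeb x v) = 0 := by
      have := h.metric x v _ _ hξx hξx
      simp only [webster, Gθ, S.πH_reeb, S.θ_reeb, map_zero, LinearMap.zero_apply,
        mvfderiv_const] at this
      simp at this
      linarith
    have hmem : cov S.reeb x v ∈ S.H x := (S.mem_H_iff x _).2 hθ0
    have := h.metric x v _ _ hξx (hext (cov S.reeb x v))
    have hZ := h.preserves_H x v (fun y => S.πH y (FiberBundle.extend (Model m)
      (cov S.reeb x v) y)) (hext (cov S.reeb x v))
    rw [S.mem_H_iff] at hZ
    change S.θ x (cov (S.horizontalPart (FiberBundle.extend (Model m) (cov S.reeb x v))) x v) = 0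
      at hZ
    simp only [webster, Gθ, S.πH_reeb, S.θ_reeb, map_zero, LinearMap.zero_apply, hZ, hθ0] at this
    simp only [horizontalPart, S.θ_coe, FiberBundle.extend_apply_self, S.πH_coe] at this
    simp only [mul_zero, add_zero, mvfderiv_const] at this
    by_contra hne
    have hp := S.levi_pos x ⟨_, hmem⟩ (by simpa using hne)
    have h3 : S.πH x (cov S.reeb x v) = ⟨_, hmem⟩ := S.πH_coe x ⟨_, hmem⟩
    rw [h3] at this
    simp at this
    exact hp.ne this
  have hsplit : cov Y x v = cov (S.horizontalPart Y) x v
      + mvfderiv 𝓘(ℝ, Model m) (fun y => S.θ y (Y y)) x v • S.reeb x := by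
    have h1 : Y = S.horizontalPart Y + (fun y => S.θ y (Y y)) • S.reeb := by
      ext1 y; simp [horizontalPart, πH]
    have hθY := S.θ_smooth.mdiffAt hYx
    conv_lhs => rw [h1]
    rw [cov.isCovariantDerivativeOnUniv.add hYH (hθY.smul_section hξx),
      cov.isCovariantDerivativeOnUniv.leibniz hξx hθY]
    simp [hpar]
  have hH : ∀ w, cov (S.horizontalPart Y) x w ∈ S.H x := fun w =>
    h.preserves_H x w (fun y => S.πH y (Y y)) hYH
  have hhor : (cov (S.horizontalPart Y) x (S.πH x v) : TangentSpace 𝓘(ℝ, Model m) x) =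
      ∑ i, ((1 / 2) * S.koszul (S.horizontalPart (FiberBundle.extend (Model m) v))
        (S.horizontalPart Y)
        (S.horizontalPart (FiberBundle.extend (Model m)
          (S.frame x i : TangentSpace 𝓘(ℝ, Model m) x))) x) •
      (S.frame x i : TangentSpace 𝓘(ℝ, Model m) x) := by
    have h1 := S.sum_frame x ⟨_, hH (S.πH x v)⟩
    have h2 := congrArg (Subtype.val) h1
    refine h2.symm.trans ?_
    simp only [AddSubmonoidClass.coe_finsetSum, Submodule.coe_smul]
    refine Finset.sum_congr rfl fun i _ => ?_
    congr 1
    have := h.koszul_eq S (fun y => S.πH y (FiberBundle.extend (Model m) v y))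
      (fun y => S.πH y (Y y)) (fun y => S.πH y (FiberBundle.extend (Model m)
          (S.frame x i : TangentSpace 𝓘(ℝ, Model m) x) y)) (hext v) hYH (hext _)
    refine Eq.symm ?_
    rw [show S.koszul (S.horizontalPart (FiberBundle.extend (Model m) v)) (S.horizontalPart Y)
      (S.horizontalPart (FiberBundle.extend (Model m)
        (S.frame x i : TangentSpace 𝓘(ℝ, Model m) x))) x = _ from this]
    simp only [FiberBundle.extend_apply_self, S.πH_coe]
    have h4 := S.πH_coe x ⟨_, hH (S.πH x v)⟩
    rw [← h4, ← mul_assoc, one_div, inv_mul_cancel₀ two_ne_zero, one_mul]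
    rfl
  have hver : cov (S.horizontalPart Y) x (S.reeb x) = (1 / 2 : ℝ) •
      ((S.πH x (mlieBracket 𝓘(ℝ, Model m) S.reeb (S.horizontalPart Y) x) :
          TangentSpace 𝓘(ℝ, Model m) x)
        - S.Jext x (mlieBracket 𝓘(ℝ, Model m) S.reeb (fun y => S.Jext y (Y y)) x)) := by
    have h1 := h.torsion_reeb x (S.horizontalPart Y x)
    have hJ : ∀ y, S.Jext y (S.horizontalPart Y y) = S.Jext y (Y y) := fun y => by
      simp [Jext, horizontalPart, S.πH_coe]
    have hJJ : ∀ w, S.Jext x (S.Jext x w) = - (S.πH x w : TangentSpace 𝓘(ℝ, Model m) x) :=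
      fun w => by simp [Jext, S.πH_coe, S.J_sq]
    have h2 := h.J_parallel x (S.reeb x) _ hYH
    rw [hJ, cov.torsion_apply hξx hYH, show S.Jext x (Y x) = (fun y => S.Jext y (Y y)) x from rfl,
      cov.torsion_apply hξx hJY, hpar, hpar] at h1
    simp only [hJ] at h2
    rw [h2] at h1
    have h3 := congrArg (S.Jext x) h1
    simp only [map_add, map_sub, map_zero, hJJ, sub_zero] at h3
    have h5 := S.πH_coe x ⟨_, hH (S.reeb x)⟩
    simp only at h5
    rw [h5] at h3
    have h6 : (2 : ℝ) • cov (S.horizontalPart Y) x (S.reeb x) =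
      ((S.πH x (mlieBracket 𝓘(ℝ, Model m) S.reeb (S.horizontalPart Y) x) :
          TangentSpace 𝓘(ℝ, Model m) x)
        - S.Jext x (mlieBracket 𝓘(ℝ, Model m) S.reeb (fun y => S.Jext y (Y y)) x)) := by
      rw [two_smul]
      rw [← sub_eq_zero, ← neg_eq_zero, ← h3]
      abel
    rw [← h6, smul_smul]; norm_num
  have hv : v = S.πH x v + S.θ x v • S.reeb x := by simp [πH]
  rw [hsplit]
  simp only [tanakaWebster]
  rw [← hhor]
  have h7 : cov (S.horizontalPart Y) x v = cov (S.horizontalPart Y) x (S.πH x v)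
      + S.θ x v • cov (S.horizontalPart Y) x (S.reeb x) := by
    conv_lhs => rw [hv]
    rw [map_add, map_smul]
  rw [h7, hver, smul_smul]
  simp only [div_eq_mul_inv, one_mul]

/-- `gradient` is the gradient for the Webster metric. -/
theorem webster_gradient (u : M → ℝ) (x : M) (v : TangentSpace 𝓘(ℝ, Model m) x) :
    S.webster x (S.gradient u x) v = mvfderiv 𝓘(ℝ, Model m) u x v := by
  have hv : v = S.πH x v + S.θ x v • S.reeb x := by simp [πH]
  conv_rhs => rw [hv, map_add, map_smul, ← S.sum_frame x (S.πH x v)]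
  simp [webster, Gθ, gradient, S.πH_coe, S.πH_reeb, S.θ_coe, S.θ_reeb,
    S.levi_symm x (S.frame x _), mul_comm]

end PseudoHermitian

end PseudoHermitianGeometry

end

/-! The theorem rests on an Omori-Yau principle for `Δ_b`. Suppose `h` is proper and `C²`, with
`|∇^H h|²` and `Δ_b h` bounded above by `C`. For `w` bounded above and `ε > 0`, the function `w - ε
h` attains its maximum. There `dw = ε dh` and `Δ_b w ≤ ε Δ_b h`, so `|∇^H w|²` and `Δ_b w` are
almost nonpositive, while `w` is almost as large as at any prescribed point (`exists_almost_max`).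

Such an `h` is `ψ ∘ γ`, where `ψ' = G^(-1/2)` far out (`exists_cutoff_primitive`,
`exists_proper_function`). Non-integrability of `G^(-1/2)` makes `ψ` unbounded; the limsup condition
bounds both `ψ'² |∇^H γ|²` and `ψ' Δ_b γ`; monotonicity of `G` gives `ψ'' ≤ 0` where the cut-off is
over.

If `u` is bounded above, the principle applied to `u` contradicts `Δ_b u ≥ c₀ u^d`. If `d > 1`, `u`
may be unbounded and the principle is applied to the bounded function `-(1 + u)^(-a)` with `a = (d -
1)/2`. This transform is concave, and the resulting negative gradient term is absorbed by the
smallness of its own horizontal gradient (`eq_zero_of_superlinear`). -/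

namespace PseudoHermitianGeometry

/-! ### Chain rules and derivative tests along coordinate lines -/

section Calculus

variable {m : ℕ} {M : Type*} [TopologicalSpace M] [ChartedSpace (Model m) M]
  [IsManifold 𝓘(ℝ, Model m) ∞ M]

/-- The derivative of a `C²` function along a differentiable vector field is differentiable. -/
lemma mdifferentiableAt_mvfderiv {u : M → ℝ} (hu : ContMDiff 𝓘(ℝ, Model m) 𝓘(ℝ) 2 u)
    {W : VecField m M} {x : M} (hW : DiffAt W x) :
    MDifferentiableAt 𝓘(ℝ, Model m) 𝓘(ℝ) (fun y => mvfderiv 𝓘(ℝ, Model m) u y (W y)) x := by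
  have : IsManifold 𝓘(ℝ, Model m) 1 M := IsManifold.of_le (n := ∞) (by simp)
  -- The tangent map of a `C²` function is `C¹` on the tangent bundle; composing it with the section
  -- `W` needs only differentiability of `W`.
  have h1 : ContMDiff 𝓘(ℝ, Model m).tangent 𝓘(ℝ).tangent 1
      (tangentMap 𝓘(ℝ, Model m) 𝓘(ℝ) u) :=
    hu.contMDiff_tangentMap (by norm_num)
  have h2 : ContMDiff 𝓘(ℝ, Model m).tangent 𝓘(ℝ) 1
      (fun p : TangentBundle 𝓘(ℝ, Model m) M => (tangentMap 𝓘(ℝ, Model m) 𝓘(ℝ) u p).2) :=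
    (contMDiff_snd_tangentBundle_modelSpace (n := 1) ℝ 𝓘(ℝ)).comp h1
  exact MDifferentiableAt.comp
    (g := fun p : TangentBundle 𝓘(ℝ, Model m) M => (tangentMap 𝓘(ℝ, Model m) 𝓘(ℝ) u p).2) x
    ((h2 _).mdifferentiableAt (by simp)) hW

omit [IsManifold 𝓘(ℝ, Model m) ∞ M] in
/-- The chain rule for real functions of a function on a manifold. -/
lemma mvfderiv_real_comp {u : M → ℝ} {x : M} {F : ℝ → ℝ} (hF : DifferentiableAt ℝ F (u x))
    (hu : MDifferentiableAt 𝓘(ℝ, Model m) 𝓘(ℝ) u x) (v : TangentSpace 𝓘(ℝ, Model m) x) :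
    mvfderiv 𝓘(ℝ, Model m) (fun y => F (u y)) x v
      = deriv F (u x) * mvfderiv 𝓘(ℝ, Model m) u x v := by
  have h := HasMFDerivAt.comp x (hF.hasDerivAt.hasFDerivAt.hasMFDerivAt) hu.hasMFDerivAt
  have h' := h.mfderiv
  simp only [mvfderiv]
  change mfderiv 𝓘(ℝ, Model m) 𝓘(ℝ) (F ∘ u) x v = _
  rw [h']
  change (show ℝ from mfderiv 𝓘(ℝ, Model m) 𝓘(ℝ) u x v) * deriv F (u x) = _
  rw [mul_comm]
  rfl

omit [IsManifold 𝓘(ℝ, Model m) ∞ M] in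
lemma mvfderiv_sub_const_mul {f h : M → ℝ} {x : M} {ε : ℝ}
    (hf : MDifferentiableAt 𝓘(ℝ, Model m) 𝓘(ℝ) f x)
    (hh : MDifferentiableAt 𝓘(ℝ, Model m) 𝓘(ℝ) h x) (v : TangentSpace 𝓘(ℝ, Model m) x) :
    mvfderiv 𝓘(ℝ, Model m) (fun y => f y - ε * h y) x v
      = mvfderiv 𝓘(ℝ, Model m) f x v - ε * mvfderiv 𝓘(ℝ, Model m) h x v := by
  have h0 : MDifferentiableAt 𝓘(ℝ, Model m) 𝓘(ℝ) (fun _ : M => ε) x := mdifferentiableAt_const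
  have h1 : MDifferentiableAt 𝓘(ℝ, Model m) 𝓘(ℝ) ((fun _ : M => ε) * h) x := h0.mul hh
  have := mvfderiv_sub hf h1
  rw [mvfderiv_mul h0 hh, mvfderiv_const] at this
  have := DFunLike.congr_fun this v
  simp only [smul_zero, add_zero, sub_apply, smul_apply, smul_eq_mul] at this
  exact this

/-- The coordinate line through `x` in the direction `w`. -/
noncomputable def chartLine (x : M) (w : Model m) (t : ℝ) : M :=
  (extChartAt 𝓘(ℝ, Model m) x).symm (extChartAt 𝓘(ℝ, Model m) x x + t • w)

omit [IsManifold 𝓘(ℝ, Model m) ∞ M] in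
lemma chartLine_zero (x : M) (w : Model m) : chartLine x w 0 = x := by
  simp [chartLine]

/-- The coordinate line is an integral curve of the extension of its initial velocity. -/
lemma eventually_hasMFDerivAt_chartLine (x : M) (w : Model m) :
    ∀ᶠ t in 𝓝 (0 : ℝ), HasMFDerivAt 𝓘(ℝ) 𝓘(ℝ, Model m) (chartLine x w) t
      (ContinuousLinearMap.toSpanSingleton ℝ
        (FiberBundle.extend (Model m) (show TangentSpace 𝓘(ℝ, Model m) x from w) (chartLine x w t))) := by
  have : IsManifold 𝓘(ℝ, Model m) 1 M := IsManifold.of_le (n := ∞) (by simp)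
  set e := extChartAt 𝓘(ℝ, Model m) x with he
  have hline : Continuous fun t : ℝ => e x + t • w := by fun_prop
  have hev : ∀ᶠ t in 𝓝 (0 : ℝ), e x + t • w ∈ e.target := by
    refine hline.continuousAt.eventually_mem ?_
    rw [zero_smul, add_zero]
    exact extChartAt_target_mem_nhds (I := 𝓘(ℝ, Model m)) x
  filter_upwards [hev] with t ht
  have hsrc : chartLine x w t ∈ (chartAt (Model m) x).source := by
    rw [← extChartAt_source 𝓘(ℝ, Model m)]
    exact e.map_target ht
  have h1 : HasMFDerivAt 𝓘(ℝ) 𝓘(ℝ, Model m) (fun t : ℝ => e x + t • w) t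
      (ContinuousLinearMap.toSpanSingleton ℝ w) := by
    apply HasFDerivAt.hasMFDerivAt
    have := ((hasDerivAt_id t).smul_const w).const_add (e x)
    rw [one_smul] at this
    exact this.hasFDerivAt
  have h2 := (mdifferentiableWithinAt_extChartAt_symm (I := 𝓘(ℝ, Model m)) ht)
  have h3 := TangentBundle.symmL_trivializationAt (I := 𝓘(ℝ, Model m)) hsrc
  have h4 : extChartAt 𝓘(ℝ, Model m) x (chartLine x w t) = e x + t • w :=
    e.right_inv ht
  rw [h4] at h3
  rw [modelWithCornersSelf_coe, range_id, mdifferentiableWithinAt_univ] at h2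
  rw [modelWithCornersSelf_coe, range_id, mfderivWithin_univ] at h3
  have h5 := HasMFDerivAt.comp t h2.hasMFDerivAt h1
  rw [← h3] at h5
  -- The trivialization centred at `x` is the identity on the fibre over `x`, so
  -- `FiberBundle.extend` is the field with constant coordinate vector `w`, which is the velocity of
  -- the line.
  have hw : (trivializationAt (Model m) (TangentSpace 𝓘(ℝ, Model m)) x
      ⟨x, (show TangentSpace 𝓘(ℝ, Model m) x from w)⟩).2 = w := by
    have h6 := TangentBundle.continuousLinearMapAt_trivializationAt (I := 𝓘(ℝ, Model m))
      (mem_chart_source (Model m) x)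
    rw [mfderiv_extChartAt_self] at h6
    have h7 := DFunLike.congr_fun h6 (show TangentSpace 𝓘(ℝ, Model m) x from w)
    have hb : x ∈ (trivializationAt (Model m) (TangentSpace 𝓘(ℝ, Model m)) x).baseSet :=
      FiberBundle.mem_baseSet_trivializationAt' x
    rw [Bundle.Trivialization.continuousLinearMapAt_apply,
      Bundle.Trivialization.linearMapAt_apply, if_pos hb] at h7
    exact h7
  have hV : FiberBundle.extend (Model m) (show TangentSpace 𝓘(ℝ, Model m) x from w)
      (chartLine x w t) = (trivializationAt (Model m) (TangentSpace 𝓘(ℝ, Model m)) x).symmL ℝ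
        (chartLine x w t) w := by
    rw [FiberBundle.extend, hw]
    refine (Bundle.Trivialization.symmL_apply _ ?_ _).symm
    rwa [TangentBundle.trivializationAt_baseSet]
  rw [hV]
  exact h5.congr_mfderiv (ContinuousLinearMap.ext fun r : ℝ =>
    map_smul ((trivializationAt (Model m) (TangentSpace 𝓘(ℝ, Model m)) x).symmL ℝ
        (chartLine x w t)) r w)

omit [IsManifold 𝓘(ℝ, Model m) ∞ M] in
/-- The derivative of a function along a curve. -/
lemma hasDerivAt_comp_curve {u : M → ℝ} {c : ℝ → M} {t : ℝ}
    {V : TangentSpace 𝓘(ℝ, Model m) (c t)} (hu : MDifferentiableAt 𝓘(ℝ, Model m) 𝓘(ℝ) u (c t))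
    (hc : HasMFDerivAt 𝓘(ℝ) 𝓘(ℝ, Model m) c t (ContinuousLinearMap.toSpanSingleton ℝ V)) :
    HasDerivAt (fun s => u (c s)) (mvfderiv 𝓘(ℝ, Model m) u (c t) V) t := by
  have h := (HasMFDerivAt.comp t hu.hasMFDerivAt hc).hasFDerivAt
  rw [hasDerivAt_iff_hasFDerivAt]
  refine HasFDerivAt.congr_fderiv h (ContinuousLinearMap.ext_ring ?_)
  refine (congrArg (mfderiv 𝓘(ℝ, Model m) 𝓘(ℝ) u (c t)) (one_smul ℝ V)).trans ?_
  exact (one_smul ℝ (mvfderiv 𝓘(ℝ, Model m) u (c t) V)).symm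

/-- Fermat's theorem in one variable, applied along the coordinate line in the direction `w`. -/
lemma mvfderiv_eq_zero_of_isLocalMax {f : M → ℝ} (hf : MDifferentiable 𝓘(ℝ, Model m) 𝓘(ℝ) f)
    {x : M} (hx : IsLocalMax f x) (w : TangentSpace 𝓘(ℝ, Model m) x) :
    mvfderiv 𝓘(ℝ, Model m) f x w = 0 := by
  have hc := (eventually_hasMFDerivAt_chartLine x w).self_of_nhds
  set c := chartLine x w with hcdef
  have hc0 : c 0 = x := chartLine_zero x w
  have hmax : IsLocalMax (fun t => f (c t)) 0 :=
    IsLocalMax.comp_continuous (g := c) (b := 0) (by rwa [hc0]) hc.continuousAt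
  have h := hmax.hasDerivAt_eq_zero (hasDerivAt_comp_curve (hf _) hc)
  -- `c 0 = x` is not definitional, so the vector is carried to the tangent space at `c 0` as a
  -- value of its extension.
  have : ∀ y, y = x → mvfderiv 𝓘(ℝ, Model m) f x w
      = mvfderiv 𝓘(ℝ, Model m) f y (FiberBundle.extend (Model m) w y) := by
    rintro y rfl; rw [FiberBundle.extend_apply_self]
  exact (this _ hc0).trans h

/-- The second derivative test in the direction of a coordinate line. -/
lemma mvfderiv_mvfderiv_nonpos_of_isLocalMax {f : M → ℝ}
    (hf : ContMDiff 𝓘(ℝ, Model m) 𝓘(ℝ) 2 f) {x : M} (hx : IsLocalMax f x)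
    (w : TangentSpace 𝓘(ℝ, Model m) x) :
    mvfderiv 𝓘(ℝ, Model m)
      (fun y => mvfderiv 𝓘(ℝ, Model m) f y (FiberBundle.extend (Model m) w y)) x w ≤ 0 := by
  have hfd : MDifferentiable 𝓘(ℝ, Model m) 𝓘(ℝ) f := hf.mdifferentiable (by simp)
  have hev := eventually_hasMFDerivAt_chartLine x w
  have hc := hev.self_of_nhds
  set c := chartLine x w with hcdef
  have hc0 : c 0 = x := chartLine_zero x w
  have hmax : IsLocalMax (fun t => f (c t)) 0 :=
    IsLocalMax.comp_continuous (g := c) (b := 0) (by rwa [hc0]) hc.continuousAt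
  set g : M → ℝ := fun y => mvfderiv 𝓘(ℝ, Model m) f y (FiberBundle.extend (Model m) w y) with hg
  have hgd : MDifferentiableAt 𝓘(ℝ, Model m) 𝓘(ℝ) g x :=
    mdifferentiableAt_mvfderiv hf (FiberBundle.mdifferentiableAt_extend ..)
  have hd1 : deriv (fun t => f (c t)) =ᶠ[𝓝 0] fun t => g (c t) := by
    filter_upwards [hev] with t ht using (hasDerivAt_comp_curve (hfd _) ht).deriv
  have hd2 : HasDerivAt (fun t => g (c t)) (mvfderiv 𝓘(ℝ, Model m) g x w) 0 := by
    have hgd' : MDifferentiableAt 𝓘(ℝ, Model m) 𝓘(ℝ) g (c 0) := by rwa [hc0]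
    refine (hasDerivAt_comp_curve hgd' hc).congr_deriv ?_
    have : ∀ y, y = x → mvfderiv 𝓘(ℝ, Model m) g x w
      = mvfderiv 𝓘(ℝ, Model m) g y (FiberBundle.extend (Model m) w y) := by
      rintro y rfl; rw [FiberBundle.extend_apply_self]
    exact (this _ hc0).symm
  have hdd : deriv (deriv fun t => f (c t)) 0 = mvfderiv 𝓘(ℝ, Model m) g x w := by
    rw [hd1.deriv_eq, hd2.deriv]
  -- A positive second derivative would make `0` a local minimum as well as a local maximum, hence
  -- `f ∘ c` locally constant with second derivative zero.
  by_contra! hpos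
  have hmin := isLocalMin_of_deriv_deriv_pos (f := fun t => f (c t)) (x₀ := 0)
    (by rw [hdd]; exact hpos) hmax.deriv_eq_zero (hasDerivAt_comp_curve (hfd _) hc).continuousAt
  have hconst : (fun t => f (c t)) =ᶠ[𝓝 0] fun _ => f (c 0) := by
    filter_upwards [hmin, hmax] with t h1 h2 using le_antisymm h2 h1
  have : deriv (deriv fun t => f (c t)) 0 = 0 := by
    rw [hconst.deriv.deriv_eq]
    simp
  exact hpos.ne' (hdd.symm.trans this)

end Calculus

/-! ### The Hessian under composition and differences -/

namespace PseudoHermitian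

variable {m : ℕ} {M : Type*} [TopologicalSpace M] [ChartedSpace (Model m) M]
  [IsManifold 𝓘(ℝ, Model m) ∞ M] (S : PseudoHermitian m M)

/-- The connection enters only through a first-order term, which scales by `F'(u)`; the `F''` term
comes from the product rule for `F'(u) · W u`. Regularity of `F` is local because the transform used
later is not smooth on all of `ℝ`. -/
lemma hessian_comp {u : M → ℝ} (hu : ContMDiff 𝓘(ℝ, Model m) 𝓘(ℝ) 2 u) {F : ℝ → ℝ} {x : M}
    (hF : ContDiffAt ℝ 2 F (u x)) (v w : TangentSpace 𝓘(ℝ, Model m) x) :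
    S.hessian (fun y => F (u y)) x v w = deriv F (u x) * S.hessian u x v w
      + deriv (deriv F) (u x) * (mvfderiv 𝓘(ℝ, Model m) u x v * mvfderiv 𝓘(ℝ, Model m) u x w) := by
  have hud : MDifferentiable 𝓘(ℝ, Model m) 𝓘(ℝ) u := hu.mdifferentiable (by simp)
  set g : M → ℝ := fun y => mvfderiv 𝓘(ℝ, Model m) u y (FiberBundle.extend (Model m) w y) with hg
  have hgd : MDifferentiableAt 𝓘(ℝ, Model m) 𝓘(ℝ) g x :=
    mdifferentiableAt_mvfderiv hu (FiberBundle.mdifferentiableAt_extend ..)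
  have hev : (fun y => mvfderiv 𝓘(ℝ, Model m) (fun y => F (u y)) y
      (FiberBundle.extend (Model m) w y)) =ᶠ[𝓝 x] (fun y => deriv F (u y)) * g := by
    -- Being `C²` at a point is an open condition, so the first-order chain rule holds near `x` and
    -- can be differentiated again.
    have h1 : ∀ᶠ y in 𝓝 x, ContDiffAt ℝ 2 F (u y) :=
      hu.continuous.continuousAt.eventually (hF.eventually (by simp))
    filter_upwards [h1] with y hy
    exact mvfderiv_real_comp (hy.differentiableAt (by simp)) (hud y) _
  have hF' : DifferentiableAt ℝ (deriv F) (u x) :=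
    ((hF.derivWithin (m := 1) (by norm_num)).differentiableAt (by simp))
  have hFd : MDifferentiableAt 𝓘(ℝ, Model m) 𝓘(ℝ) (fun y => deriv F (u y)) x :=
    MDifferentiableAt.comp x hF'.mdifferentiableAt (hud x)
  have h2 : mvfderiv 𝓘(ℝ, Model m) (fun y => mvfderiv 𝓘(ℝ, Model m) (fun y => F (u y)) y
      (FiberBundle.extend (Model m) w y)) x = mvfderiv 𝓘(ℝ, Model m)
        ((fun y => deriv F (u y)) * g) x := by
    ext v
    exact congrArg (fun L : TangentSpace 𝓘(ℝ, Model m) x →L[ℝ] ℝ => L v) hev.mfderiv_eq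
  rw [hessian, hessian, h2, mvfderiv_mul hFd hgd,
    mvfderiv_real_comp (hF.differentiableAt (by simp)) (hud x)]
  simp only [add_apply, smul_apply, smul_eq_mul,
    mvfderiv_real_comp hF' (hud x)]
  simp only [hg, FiberBundle.extend_apply_self]
  ring

lemma hessian_sub_const_mul {f h : M → ℝ} (hf : ContMDiff 𝓘(ℝ, Model m) 𝓘(ℝ) 2 f)
    (hh : ContMDiff 𝓘(ℝ, Model m) 𝓘(ℝ) 2 h) (ε : ℝ) {x : M}
    (v w : TangentSpace 𝓘(ℝ, Model m) x) :
    S.hessian (fun y => f y - ε * h y) x v w = S.hessian f x v w - ε * S.hessian h x v w := by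
  have hfd : MDifferentiable 𝓘(ℝ, Model m) 𝓘(ℝ) f := hf.mdifferentiable (by simp)
  have hhd : MDifferentiable 𝓘(ℝ, Model m) 𝓘(ℝ) h := hh.mdifferentiable (by simp)
  simp only [hessian, mvfderiv_sub_const_mul (hfd _) (hhd _)]
  rw [mvfderiv_sub_const_mul (mdifferentiableAt_mvfderiv hf (FiberBundle.mdifferentiableAt_extend ..))
    (mdifferentiableAt_mvfderiv hh (FiberBundle.mdifferentiableAt_extend ..))]
  ring

end PseudoHermitian

end PseudoHermitianGeometry

/-! ### The sub-Laplacian and the Omori-Yau principle -/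

namespace PseudoHermitianGeometry
namespace PseudoHermitian

variable {m : ℕ} {M : Type*} [TopologicalSpace M] [ChartedSpace (Model m) M]
  [IsManifold 𝓘(ℝ, Model m) ∞ M] (S : PseudoHermitian m M)

/-- The squared length of the horizontal gradient, in an orthonormal frame of `H`. -/
noncomputable def horizontalNormSq (u : M → ℝ) (x : M) : ℝ :=
  ∑ i, mvfderiv 𝓘(ℝ, Model m) u x (S.frame x i) ^ 2

lemma horizontalNormSq_nonneg (u : M → ℝ) (x : M) : 0 ≤ S.horizontalNormSq u x :=
  Finset.sum_nonneg fun _ _ => sq_nonneg _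

/-- Passes from the norm in the growth hypothesis to the coordinate sum used in the estimates: `πH`
removes the Reeb component and the frame is orthonormal. -/
lemma websterNorm_horizontalGradient_sq (u : M → ℝ) (x : M) :
    S.websterNorm x (S.horizontalGradient u x) ^ 2 = S.horizontalNormSq u x := by
  have h : S.webster x (S.horizontalGradient u x) (S.horizontalGradient u x)
      = S.horizontalNormSq u x := by
    simp only [horizontalGradient, horizontalPart, gradient, webster, Gθ, S.θ_coe, S.πH_coe,
      map_add, map_sum, map_smul, S.πH_reeb, horizontalNormSq]
    simp [S.levi_frame, pow_two]
  rw [websterNorm, h, Real.sq_sqrt (S.horizontalNormSq_nonneg u x)]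

lemma subLaplacian_comp {u : M → ℝ} (hu : ContMDiff 𝓘(ℝ, Model m) 𝓘(ℝ) 2 u) {F : ℝ → ℝ} {x : M}
    (hF : ContDiffAt ℝ 2 F (u x)) :
    S.subLaplacian (fun y => F (u y)) x = deriv F (u x) * S.subLaplacian u x
      + deriv (deriv F) (u x) * S.horizontalNormSq u x := by
  simp only [subLaplacian, S.hessian_comp hu hF, horizontalNormSq, Finset.sum_add_distrib,
    Finset.mul_sum, pow_two]

lemma horizontalNormSq_comp {u : M → ℝ} {x : M} (hu : MDifferentiableAt 𝓘(ℝ, Model m) 𝓘(ℝ) u x)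
    {F : ℝ → ℝ} (hF : DifferentiableAt ℝ F (u x)) :
    S.horizontalNormSq (fun y => F (u y)) x = deriv F (u x) ^ 2 * S.horizontalNormSq u x := by
  simp only [horizontalNormSq, mvfderiv_real_comp hF hu, mul_pow, Finset.mul_sum]

lemma subLaplacian_sub_const_mul {f h : M → ℝ} (hf : ContMDiff 𝓘(ℝ, Model m) 𝓘(ℝ) 2 f)
    (hh : ContMDiff 𝓘(ℝ, Model m) 𝓘(ℝ) 2 h) (ε : ℝ) (x : M) :
    S.subLaplacian (fun y => f y - ε * h y) x = S.subLaplacian f x - ε * S.subLaplacian h x := by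
  simp only [subLaplacian, S.hessian_sub_const_mul hf hh, Finset.sum_sub_distrib, Finset.mul_sum]

/-- At a critical point the connection term vanishes, leaving a sum of second derivatives along
coordinate lines. -/
lemma subLaplacian_nonpos_of_isLocalMax {f : M → ℝ} (hf : ContMDiff 𝓘(ℝ, Model m) 𝓘(ℝ) 2 f)
    {x : M} (hx : IsLocalMax f x) : S.subLaplacian f x ≤ 0 := by
  refine Finset.sum_nonpos fun i _ => ?_
  rw [hessian, mvfderiv_eq_zero_of_isLocalMax (hf.mdifferentiable (by simp)) hx, sub_zero]
  exact mvfderiv_mvfderiv_nonpos_of_isLocalMax hf hx _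

/-- An Omori-Yau maximum principle: if there is a proper `C²` function whose horizontal gradient and
sub-Laplacian are bounded above, then every `C²` function that is bounded above has points of almost
maximal value with almost vanishing horizontal gradient and almost nonpositive sub-Laplacian. -/
theorem exists_almost_max {h : M → ℝ} (hh : ContMDiff 𝓘(ℝ, Model m) 𝓘(ℝ) 2 h)
    (hlim : Tendsto h (cocompact M) atTop) {C : ℝ} (hgrad : ∀ x, S.horizontalNormSq h x ≤ C)
    (hlap : ∀ x, S.subLaplacian h x ≤ C) {w : M → ℝ} (hw : ContMDiff 𝓘(ℝ, Model m) 𝓘(ℝ) 2 w)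
    (hbdd : BddAbove (range w)) (p : M) {η : ℝ} (hη : 0 < η) :
    ∃ x, w p - η ≤ w x ∧ S.subLaplacian w x ≤ η ∧ S.horizontalNormSq w x ≤ η := by
  obtain ⟨b, hb⟩ := hbdd
  have hb : ∀ x, w x ≤ b := fun x => hb (mem_range_self x)
  have : Nonempty M := ⟨p⟩
  obtain ⟨z, hz⟩ : ∃ z, ∀ y, h z ≤ h y := hh.continuous.exists_forall_le hlim
  have hC0 : 0 ≤ C := (S.horizontalNormSq_nonneg h p).trans (hgrad p)
  -- `ε * C ≤ η` controls the sub-Laplacian, and with `ε ≤ 1` also `ε ^ 2 * C`, the gradient bound.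
  -- The last condition limits the loss in value; the minimum `h z` replaces `h x` since `x` depends
  -- on `ε`.
  obtain ⟨ε, hε, hε1, hεC, hεp⟩ : ∃ ε : ℝ, 0 < ε ∧ ε ≤ 1 ∧ ε * C ≤ η ∧ ε * (h p - h z) ≤ η := by
    have hD : 0 ≤ h p - h z := sub_nonneg.2 (hz p)
    refine ⟨η / (η + C + (h p - h z)), by positivity, ?_, ?_, ?_⟩
    · exact (div_le_one (by positivity)).2 (by linarith)
    · rw [div_mul_eq_mul_div, div_le_iff₀ (by positivity)]; nlinarith
    · rw [div_mul_eq_mul_div, div_le_iff₀ (by positivity)]; nlinarith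
  have hf : ContMDiff 𝓘(ℝ, Model m) 𝓘(ℝ) 2 fun y => w y - ε * h y :=
    hw.sub (contMDiff_const.mul hh)
  -- `w` is bounded above and `h` is proper, so `w - ε h` tends to `-∞` at infinity.
  obtain ⟨x, hx⟩ : ∃ x, ∀ y, w y - ε * h y ≤ w x - ε * h x := by
    refine hf.continuous.exists_forall_ge ?_
    refine tendsto_atBot_mono (fun y => sub_le_sub_right (hb y) _) ?_
    exact tendsto_atBot_add_const_left _ _ (tendsto_neg_atTop_atBot.comp
      (hlim.const_mul_atTop hε))
  have hmax : IsLocalMax (fun y => w y - ε * h y) x := Eventually.of_forall hx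
  refine ⟨x, ?_, ?_, ?_⟩
  · have h1 := hx p
    have h2 := mul_le_mul_of_nonneg_left (hz x) hε.le
    nlinarith
  · have h1 := S.subLaplacian_nonpos_of_isLocalMax hf hmax
    rw [S.subLaplacian_sub_const_mul hw hh] at h1
    have h2 := mul_le_mul_of_nonneg_left (hlap x) hε.le
    linarith
  · have h1 : S.horizontalNormSq w x = ε ^ 2 * S.horizontalNormSq h x := by
      simp only [horizontalNormSq, Finset.mul_sum]
      refine Finset.sum_congr rfl fun i _ => ?_
      have h2 := mvfderiv_eq_zero_of_isLocalMax (hf.mdifferentiable (by simp)) hmax (S.frame x i)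
      rw [mvfderiv_sub_const_mul (hw.mdifferentiable (by simp) x)
        (hh.mdifferentiable (by simp) x)] at h2
      rw [sub_eq_zero.1 h2, mul_pow]
    have h3 := mul_le_mul_of_nonneg_left (hgrad x) (sq_nonneg ε)
    have h4 : ε ^ 2 * C ≤ ε * C := by nlinarith [mul_nonneg hε.le hC0]
    linarith

end PseudoHermitian
end PseudoHermitianGeometry

/-! ### From the growth conditions to a proper function -/

namespace PseudoHermitianGeometry

lemma monotoneOn_Ici_of_derivWithin_nonneg {G : ℝ → ℝ} (hG : ContDiffOn ℝ ∞ G (Ici 0))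
    (hG_deriv : ∀ t : ℝ, 0 ≤ t → 0 ≤ derivWithin G (Ici 0) t) : MonotoneOn G (Ici 0) := by
  refine monotoneOn_of_deriv_nonneg (convex_Ici 0) hG.continuousOn ?_ ?_
  · exact (hG.differentiableOn (by simp)).mono interior_subset
  · intro x hx
    rw [interior_Ici, mem_Ioi] at hx
    rw [← derivWithin_of_mem_nhds (Ici_mem_nhds hx)]
    exact hG_deriv x hx.le

/-- A cut-off `C²` primitive of `G ^ (-1/2)`, which is unbounded because `G ^ (-1/2)` is not integrable
at infinity. -/
lemma exists_cutoff_primitive {G : ℝ → ℝ} (hG : ContDiffOn ℝ ∞ G (Ici 0)) (hG_zero : 0 < G 0)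
    (hG_deriv : ∀ t : ℝ, 0 ≤ t → 0 ≤ derivWithin G (Ici 0) t)
    (hG_int : ¬ IntegrableAtFilter (fun t : ℝ => G t ^ (-(1 / 2) : ℝ)) atTop volume)
    {R : ℝ} (hR : 0 < R) :
    ∃ ψ : ℝ → ℝ, ContDiff ℝ 2 ψ ∧ Tendsto ψ atTop atTop ∧ (∀ t < R, deriv ψ t = 0) ∧
      (∀ t, R ≤ t → 0 ≤ deriv ψ t ∧ deriv ψ t ≤ (√(G t))⁻¹) ∧
      ∃ C : ℝ, 0 ≤ C ∧ ∀ t, R ≤ t → t * deriv (deriv ψ) t ≤ C := by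
  have hmono := monotoneOn_Ici_of_derivWithin_nonneg hG hG_deriv
  have hpos : ∀ t, 0 ≤ t → 0 < G t := fun t ht =>
    hG_zero.trans_le (hmono (mem_Ici.2 le_rfl) ht ht)
  have hGat : ∀ t, 0 < t → ContDiffAt ℝ ∞ G t := fun t ht =>
    (hG t ht.le).contDiffAt (Ici_mem_nhds ht)
  -- Zero up to `R` and one from `R + 1` on: `κ` makes the integrand `C¹` on all of `ℝ`, although
  -- `G` is controlled only on `[0, ∞)`.
  set κ : ℝ → ℝ := fun s => Real.smoothTransition (s - R) with hκ
  have hκc : ContDiff ℝ ∞ κ := Real.smoothTransition.contDiff.comp (contDiff_id.sub contDiff_const)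
  have hκ0 : ∀ s, 0 ≤ κ s := fun s => Real.smoothTransition.nonneg _
  have hκ1 : ∀ s, κ s ≤ 1 := fun s => Real.smoothTransition.le_one _
  set k : ℝ → ℝ := fun s => κ s * (√(G s))⁻¹ with hk
  have hk0 : ∀ s, 0 ≤ k s := fun s => mul_nonneg (hκ0 s) (by positivity)
  have hkR : ∀ s < R, k s = 0 := fun s hs => by
    simp [hk, hκ, Real.smoothTransition.zero_of_nonpos (sub_nonpos.2 hs.le)]
  have hkc : ContDiff ℝ 1 k := by
    rw [contDiff_iff_contDiffAt]
    intro s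
    rcases lt_or_ge s R with hs | hs
    · refine (contDiffAt_const (c := (0 : ℝ))).congr_of_eventuallyEq ?_
      filter_upwards [Iio_mem_nhds hs] with y hy using hkR y hy
    · have hs0 := hR.trans_le hs
      have h1 := ((hGat s hs0).sqrt (hpos s hs0.le).ne').inv (Real.sqrt_pos.2 (hpos s hs0.le)).ne'
      exact (hκc.contDiffAt.mul h1).of_le (by simp)
  set ψ : ℝ → ℝ := fun t => ∫ s in (0 : ℝ)..t, k s with hψ
  have hψd : ∀ t, HasDerivAt ψ (k t) t := fun t =>
    (hkc.continuous.integral_hasStrictDerivAt 0 t).hasDerivAt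
  have hψ' : deriv ψ = k := funext fun t => (hψd t).deriv
  refine ⟨ψ, ?_, ?_, ?_, ?_, ?_⟩
  · rw [show (2 : WithTop ℕ∞) = 1 + 1 by norm_num, contDiff_succ_iff_deriv, hψ']
    exact ⟨fun t => (hψd t).differentiableAt, by simp, hkc⟩
  · have hm : Monotone ψ := monotone_of_deriv_nonneg (fun t => (hψd t).differentiableAt)
      (fun t => by rw [hψ']; exact hk0 t)
    -- If the monotone `ψ` had a finite limit, `k ≥ 0` would be integrable, and so would `G^(-1/2)`,
    -- which equals `k` beyond `R + 1`.
    rcases tendsto_atTop_of_monotone hm with h | ⟨l, hl⟩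
    · exact h
    · refine absurd ?_ hG_int
      have h1 : IntegrableOn k (Ioi 0) := by
        refine integrableOn_Ioi_of_intervalIntegral_norm_tendsto l 0
          (fun i => (hkc.continuous.integrableOn_Icc.mono_set Ioc_subset_Icc_self)) tendsto_id ?_
        simp only [Real.norm_of_nonneg (hk0 _)]
        exact hl
      refine ⟨Ici (R + 1), Ici_mem_atTop _, ?_⟩
      refine (h1.mono_set (fun t ht => ?_)).congr_fun (fun t ht => ?_) measurableSet_Ici
      · exact lt_of_lt_of_le (by linarith) (mem_Ici.1 ht)
      · have ht : R + 1 ≤ t := ht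
        have h2 : κ t = 1 := Real.smoothTransition.one_of_one_le (by linarith)
        simp only [hk, h2, one_mul]
        rw [Real.rpow_neg (hpos t (by linarith)).le, Real.sqrt_eq_rpow]
  · intro t ht
    rw [hψ', hkR t ht]
  · intro t _
    rw [hψ']
    exact ⟨hk0 t, mul_le_of_le_one_left (by positivity) (hκ1 t)⟩
  · rw [hψ']
    have hκ'c : Continuous (deriv κ) := hκc.continuous_deriv (by simp)
    -- For `t ≥ R`, `κ'` can be nonzero only on this interval. The other term of `k'` is nonpositive
    -- because `G' ≥ 0`, so only `t κ'(t)` needs a bound.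
    obtain ⟨D, hD⟩ := (isCompact_Icc (a := R) (b := R + 1)).bddAbove_image
      (f := fun s => |s * deriv κ s|) (by fun_prop)
    refine ⟨|D| * (√(G 0))⁻¹, by positivity, fun t ht => ?_⟩
    have ht0 := hR.trans_le ht
    have hGt := hpos t ht0.le
    have hq := Real.sqrt_pos.2 hGt
    have hGd : HasDerivAt G (deriv G t) t := ((hGat t ht0).differentiableAt (by simp)).hasDerivAt
    have hG' : 0 ≤ deriv G t := by
      rw [← derivWithin_of_mem_nhds (Ici_mem_nhds ht0)]
      exact hG_deriv t ht0.le
    have hκd : HasDerivAt κ (deriv κ t) t := (hκc.differentiable (by simp) t).hasDerivAt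
    have h1 : deriv k t = deriv κ t * (√(G t))⁻¹ + κ t * (-(deriv G t / (2 * √(G t))) / √(G t) ^ 2) :=
      (hκd.mul ((hGd.sqrt hGt.ne').inv hq.ne')).deriv
    have h2 : κ t * (-(deriv G t / (2 * √(G t))) / √(G t) ^ 2) ≤ 0 :=
      mul_nonpos_of_nonneg_of_nonpos (hκ0 t)
        (div_nonpos_of_nonpos_of_nonneg (neg_nonpos.2 (by positivity)) (by positivity))
    have h3 : t * deriv κ t ≤ |D| := by
      rcases le_or_gt t (R + 1) with h | h
      · exact (le_abs_self _).trans ((hD ⟨t, ⟨ht, h⟩, rfl⟩).trans (le_abs_self _))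
      · have : κ =ᶠ[𝓝 t] fun _ => 1 := by
          filter_upwards [Ioi_mem_nhds h] with s hs
          exact Real.smoothTransition.one_of_one_le (by have := mem_Ioi.1 hs; linarith)
        rw [this.deriv_eq]
        simp
    have h4 : (√(G t))⁻¹ ≤ (√(G 0))⁻¹ :=
      inv_anti₀ (Real.sqrt_pos.2 hG_zero) (Real.sqrt_le_sqrt (hmono (mem_Ici.2 le_rfl) ht0.le ht0.le))
    calc t * deriv k t ≤ (t * deriv κ t) * (√(G t))⁻¹ := by rw [h1]; nlinarith
      _ ≤ |D| * (√(G t))⁻¹ := mul_le_mul_of_nonneg_right h3 (by positivity)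
      _ ≤ |D| * (√(G 0))⁻¹ := mul_le_mul_of_nonneg_left h4 (by positivity)

namespace PseudoHermitian

variable {m : ℕ} {M : Type*} [TopologicalSpace M] [ChartedSpace (Model m) M]
  [IsManifold 𝓘(ℝ, Model m) ∞ M] (S : PseudoHermitian m M)

/-- The growth conditions on `γ` give a proper `C²` function with bounded horizontal gradient and
sub-Laplacian bounded above. -/
theorem exists_proper_function (γ : M → ℝ) (hγ : ContMDiff 𝓘(ℝ, Model m) 𝓘(ℝ) 2 γ)
    (hγ_lim : ∀ η : ℝ, 0 < η → ∃ K : Set M, IsCompact K ∧ ∀ x ∉ K, η < γ x)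
    (A B : ℝ) (hB : 0 < B)
    (hγ_grad : ∃ K : Set M, IsCompact K ∧
      ∀ x ∉ K, S.websterNorm x (S.horizontalGradient γ x) ≤ A * √(γ x))
    (G : ℝ → ℝ) (hG : ContDiffOn ℝ ∞ G (Ici 0)) (hG_zero : 0 < G 0)
    (hG_deriv : ∀ t : ℝ, 0 ≤ t → 0 ≤ derivWithin G (Ici 0) t)
    (hG_int : ¬ IntegrableAtFilter (fun t : ℝ => G t ^ (-(1 / 2) : ℝ)) atTop volume)
    (hG_limsup : ∃ C : ℝ, ∀ᶠ t : ℝ in atTop, t * G (√t) / G t ≤ C)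
    (hγ_lap : ∃ K : Set M, IsCompact K ∧
      ∀ x ∉ K, S.subLaplacian γ x ≤ B * √(γ x) * √(G (√(γ x)))) :
    ∃ h : M → ℝ, ContMDiff 𝓘(ℝ, Model m) 𝓘(ℝ) 2 h ∧ Tendsto h (cocompact M) atTop ∧
      ∃ C : ℝ, (∀ x, S.horizontalNormSq h x ≤ C) ∧ ∀ x, S.subLaplacian h x ≤ C := by
  have hmono := monotoneOn_Ici_of_derivWithin_nonneg hG hG_deriv
  have hG0 : ∀ t, 0 ≤ t → G 0 ≤ G t := fun t ht => hmono (mem_Ici.2 le_rfl) ht ht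
  obtain ⟨K₁, hK₁, hgrad⟩ := hγ_grad
  obtain ⟨K₂, hK₂, hlap⟩ := hγ_lap
  obtain ⟨c, hc⟩ := hG_limsup
  obtain ⟨T, hT⟩ := eventually_atTop.1 hc
  obtain ⟨b, hb⟩ := (hK₁.union hK₂).bddAbove_image (f := γ) hγ.continuous.continuousOn
  -- Where `γ ≥ R`, the point lies outside both compact sets (`R > b`) and the limsup bound applies
  -- (`R ≥ T`).
  set R := max (max T (b + 1)) 1 with hRdef
  have hR : 0 < R := lt_of_lt_of_le one_pos (le_max_right _ _)
  have hRT : T ≤ R := (le_max_left _ _).trans (le_max_left _ _)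
  have hRb : b < R := (lt_add_one b).trans_le ((le_max_right _ _).trans (le_max_left _ _))
  have hmem : ∀ x, R ≤ γ x → x ∉ K₁ ∧ x ∉ K₂ := fun x hx =>
    not_or.1 fun h => (hb ⟨x, h, rfl⟩).not_gt (hRb.trans_le hx)
  obtain ⟨ψ, hψ, hψlim, hψ0, hψ1, D, hD0, hD⟩ :=
    exists_cutoff_primitive hG hG_zero hG_deriv hG_int hR
  have hγ_top : Tendsto γ (cocompact M) atTop := by
    rw [tendsto_atTop]
    intro η
    obtain ⟨K, hK, hη⟩ := hγ_lim (max η 1) (lt_of_lt_of_le one_pos (le_max_right _ _))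
    filter_upwards [hK.compl_mem_cocompact] with x hx
    exact (le_max_left _ _).trans (hη x hx).le
  -- the pointwise bounds where `ψ` is not locally constant
  have hnorm : ∀ x, R ≤ γ x → S.horizontalNormSq γ x ≤ A ^ 2 * γ x := fun x hx => by
    rw [← S.websterNorm_horizontalGradient_sq]
    refine (pow_le_pow_left₀ (Real.sqrt_nonneg _) (hgrad x (hmem x hx).1) 2).trans_eq ?_
    rw [mul_pow, Real.sq_sqrt (hR.le.trans hx)]
  have hc0 : ∀ t, R ≤ t → t * G (√t) / G t ≤ c := fun t ht => hT t (hRT.trans ht)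
  have hGpos : ∀ t, 0 ≤ t → 0 < G t := fun t ht => hG_zero.trans_le (hG0 t ht)
  have hd0 : ∀ t < R, deriv (deriv ψ) t = 0 := fun t ht => by
    have : deriv ψ =ᶠ[𝓝 t] fun _ => 0 := by
      filter_upwards [Iio_mem_nhds ht] with s hs using hψ0 s hs
    rw [this.deriv_eq]; simp
  have hc_nonneg : 0 ≤ c := by
    have h1 := hGpos (√R) (Real.sqrt_nonneg _)
    have h2 := hGpos R hR.le
    exact (by positivity : 0 ≤ R * G (√R) / G R).trans (hc0 R le_rfl)
  refine ⟨fun x => ψ (γ x), (hψ.contMDiff).comp hγ, hψlim.comp hγ_top,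
    max (A ^ 2 * (c / G 0)) (B * √c + A ^ 2 * D), fun x => ?_, fun x => ?_⟩
  · rw [S.horizontalNormSq_comp (hγ.mdifferentiable (by simp) x)
      (hψ.differentiable (by simp) _)]
    refine le_max_of_le_left ?_
    rcases lt_or_ge (γ x) R with hx | hx
    · rw [hψ0 _ hx]
      have := div_nonneg hc_nonneg hG_zero.le
      nlinarith [mul_nonneg (sq_nonneg A) this]
    · have ht := hR.trans_le hx
      have hGt := hGpos _ ht.le
      obtain ⟨h1, h2⟩ := hψ1 _ hx
      have h3 : deriv ψ (γ x) ^ 2 ≤ (G (γ x))⁻¹ := by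
        refine (pow_le_pow_left₀ h1 h2 2).trans_eq ?_
        rw [inv_pow, Real.sq_sqrt hGt.le]
      -- From `t G(√t) ≤ c G(t)` and `G(√t) ≥ G(0)`.
      have h4 : γ x / G (γ x) ≤ c / G 0 := by
        have h5 := hc0 _ hx
        rw [div_le_iff₀ hGt] at h5
        rw [div_le_div_iff₀ hGt hG_zero]
        exact (mul_le_mul_of_nonneg_left (hG0 _ (Real.sqrt_nonneg _)) ht.le).trans h5
      calc deriv ψ (γ x) ^ 2 * S.horizontalNormSq γ x ≤ (G (γ x))⁻¹ * (A ^ 2 * γ x) :=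
            mul_le_mul h3 (hnorm x hx) (S.horizontalNormSq_nonneg _ _) (by positivity)
        _ = A ^ 2 * (γ x / G (γ x)) := by ring
        _ ≤ A ^ 2 * (c / G 0) := mul_le_mul_of_nonneg_left h4 (sq_nonneg A)
  · rw [S.subLaplacian_comp hγ hψ.contDiffAt]
    refine le_max_of_le_right ?_
    rcases lt_or_ge (γ x) R with hx | hx
    · rw [hψ0 _ hx, hd0 _ hx]
      have := Real.sqrt_nonneg c
      simp only [zero_mul, add_zero]
      positivity
    · have ht := hR.trans_le hx
      have hGt := hGpos _ ht.le
      obtain ⟨h1, h2⟩ := hψ1 _ hx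
      have h3 : deriv ψ (γ x) * S.subLaplacian γ x ≤ B * √c := by
        -- The left side is the square root of the quotient in the limsup condition.
        have h4 : (√(G (γ x)))⁻¹ * (√(γ x) * √(G (√(γ x)))) ≤ √c := by
          rw [← Real.sqrt_mul ht.le, ← Real.sqrt_inv, ← Real.sqrt_mul (inv_nonneg.2 hGt.le)]
          refine Real.sqrt_le_sqrt ?_
          rw [inv_mul_eq_div]
          exact hc0 _ hx
        calc deriv ψ (γ x) * S.subLaplacian γ x
            ≤ deriv ψ (γ x) * (B * √(γ x) * √(G (√(γ x)))) :=
              mul_le_mul_of_nonneg_left (hlap x (hmem x hx).2) h1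
          _ ≤ (√(G (γ x)))⁻¹ * (B * √(γ x) * √(G (√(γ x)))) :=
              mul_le_mul_of_nonneg_right h2 (by positivity)
          _ = B * ((√(G (γ x)))⁻¹ * (√(γ x) * √(G (√(γ x))))) := by ring
          _ ≤ B * √c := mul_le_mul_of_nonneg_left h4 hB.le
      have h5 : deriv (deriv ψ) (γ x) * S.horizontalNormSq γ x ≤ A ^ 2 * D := by
        -- Only an upper bound is needed, so a negative `ψ''` is harmless however large.
        rcases le_or_gt (deriv (deriv ψ) (γ x)) 0 with h6 | h6
        · exact (mul_nonpos_of_nonpos_of_nonneg h6 (S.horizontalNormSq_nonneg _ _)).trans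
            (by positivity)
        · calc deriv (deriv ψ) (γ x) * S.horizontalNormSq γ x
              ≤ deriv (deriv ψ) (γ x) * (A ^ 2 * γ x) :=
                mul_le_mul_of_nonneg_left (hnorm x hx) h6.le
            _ = A ^ 2 * (γ x * deriv (deriv ψ) (γ x)) := by ring
            _ ≤ A ^ 2 * D := mul_le_mul_of_nonneg_left (hD _ hx) (sq_nonneg A)
      linarith

end PseudoHermitian
end PseudoHermitianGeometry

/-! ### The superlinear case, through a bounded transform -/

/-- The bounded transform `s ↦ -(1 + s) ^ (-a)`. -/
lemma hasDerivAt_neg_one_add_rpow (a : ℝ) {s : ℝ} (hs : -1 < s) :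
    HasDerivAt (fun s : ℝ => -(1 + s) ^ (-a)) (a * (1 + s) ^ (-a - 1)) s := by
  have h := ((hasDerivAt_id s).const_add 1).rpow_const (p := -a)
    (Or.inl (by simp only [id]; linarith))
  refine h.neg.congr_deriv ?_
  simp only [id]
  ring

lemma deriv_deriv_neg_one_add_rpow (a : ℝ) {s : ℝ} (hs : -1 < s) :
    deriv (deriv fun s : ℝ => -(1 + s) ^ (-a)) s = -(a * (a + 1) * (1 + s) ^ (-a - 2)) := by
  have hev : deriv (fun s : ℝ => -(1 + s) ^ (-a)) =ᶠ[𝓝 s] fun s => a * (1 + s) ^ (-a - 1) := by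
    filter_upwards [Ioi_mem_nhds hs] with t ht using (hasDerivAt_neg_one_add_rpow a ht).deriv
  rw [hev.deriv_eq]
  have h := (((hasDerivAt_id s).const_add 1).rpow_const (p := -a - 1)
    (Or.inl (by simp only [id]; linarith))).const_mul a
  refine h.deriv.trans ?_
  simp only [id]
  rw [show -a - 1 - 1 = -a - 2 by ring]
  ring

namespace PseudoHermitianGeometry.PseudoHermitian

variable {m : ℕ} {M : Type*} [TopologicalSpace M] [ChartedSpace (Model m) M]
  [IsManifold 𝓘(ℝ, Model m) ∞ M] (S : PseudoHermitian m M)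

/-- A nonnegative solution of `Δ_b u ≥ c₀ u ^ d` with `d > 1` vanishes. -/
theorem eq_zero_of_superlinear {h : M → ℝ} (hh : ContMDiff 𝓘(ℝ, Model m) 𝓘(ℝ) 2 h)
    (hlim : Tendsto h (cocompact M) atTop) {C : ℝ} (hgrad : ∀ x, S.horizontalNormSq h x ≤ C)
    (hlap : ∀ x, S.subLaplacian h x ≤ C) {u : M → ℝ} (hu : ContMDiff 𝓘(ℝ, Model m) 𝓘(ℝ) 2 u)
    {c₀ d : ℝ} (hc₀ : 0 < c₀) (hd : 1 < d) (hineq : ∀ x, c₀ * u x ^ d ≤ S.subLaplacian u x)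
    (hpos : ∀ x, 0 ≤ u x) (p : M) : u p = 0 := by
  by_contra hne
  have hp : 0 < u p := lt_of_le_of_ne (hpos p) (Ne.symm hne)
  -- With `P = (1 + s)^a` this exponent gives `(1 + s)^d = P² (1 + s)`. Then `F'(s) s^d = a P
  -- (s/(1+s))^d`, while `|F''| |∇^H u|² = ((a + 1)/a) P |∇^H F(u)|²`: both carry the same factor
  -- `P`, which cancels.
  set a : ℝ := (d - 1) / 2 with ha_def
  have ha : 0 < a := by rw [ha_def]; linarith
  set F : ℝ → ℝ := fun s => -(1 + s) ^ (-a) with hF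
  have hFc : ∀ s, 0 ≤ s → ContDiffAt ℝ 2 F s := fun s hs =>
    ((contDiffAt_const.add contDiffAt_id).rpow_const_of_ne (by simp only [id]; linarith)).neg
  have hw : ContMDiff 𝓘(ℝ, Model m) 𝓘(ℝ) 2 fun x => F (u x) := fun x =>
    (hFc _ (hpos x)).contMDiffAt.comp x (hu x)
  have hbdd : BddAbove (range fun x => F (u x)) := by
    refine ⟨0, ?_⟩
    rintro _ ⟨x, rfl⟩
    exact neg_nonpos.2 (Real.rpow_nonneg (by linarith [hpos x]) _)
  -- a level below `u p` that almost maximal points stay above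
  set δ := u p / 2 with hδ_def
  have hδ : 0 < δ := half_pos hp
  have hFδ : F δ < F (u p) := by
    refine neg_lt_neg (Real.rpow_lt_rpow_of_neg (by linarith) ?_ (neg_neg_of_pos ha))
    linarith
  set q := a ^ 2 * c₀ * (δ / (1 + δ)) ^ d with hq_def
  have hq : 0 < q := by positivity
  -- The first bound forces `u x > δ`. The second contradicts the final estimate, where `2a + 1 = a
  -- + (a + 1)` collects the sub-Laplacian and gradient errors.
  obtain ⟨η, hη, hη1, hη2⟩ : ∃ η : ℝ, 0 < η ∧ η < F (u p) - F δ ∧ η * (2 * a + 1) < q := by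
    have h1 : 0 < F (u p) - F δ := sub_pos.2 hFδ
    have h2 : 0 < q / (2 * a + 1) := by positivity
    obtain ⟨η, h3, h4⟩ := exists_between (lt_min h1 h2)
    exact ⟨η, h3, h4.trans_le (min_le_left _ _),
      (lt_div_iff₀ (by positivity)).1 (h4.trans_le (min_le_right _ _))⟩
  obtain ⟨x, hx1, hx2, hx3⟩ := S.exists_almost_max hh hlim hgrad hlap hw hbdd p hη
  set s := u x with hs_def
  have hs0 : 0 ≤ s := hpos x
  have hs1 : (0 : ℝ) < 1 + s := by linarith
  have hsδ : δ < s := by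
    by_contra! hle
    have h1 : F s ≤ F δ :=
      neg_le_neg (Real.rpow_le_rpow_of_nonpos hs1 (by linarith) (neg_nonpos.2 ha.le))
    have h2 : F (u p) - η ≤ F s := hx1
    linarith
  have hF1 : deriv F s = a * (1 + s) ^ (-a - 1) :=
    (hasDerivAt_neg_one_add_rpow a (by linarith)).deriv
  have hF2 : deriv (deriv F) s = -(a * (a + 1) * (1 + s) ^ (-a - 2)) :=
    deriv_deriv_neg_one_add_rpow a (by linarith)
  rw [S.subLaplacian_comp hu (hFc _ hs0), hF1, hF2] at hx2
  rw [S.horizontalNormSq_comp (hu.mdifferentiable (by simp) x)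
    ((hFc _ hs0).differentiableAt (by simp)), hF1] at hx3
  set N := S.horizontalNormSq u x
  set P := (1 + s) ^ a with hP
  have hP1 : 1 ≤ P := Real.one_le_rpow (by linarith) ha.le
  have hP0 : 0 < P := by linarith
  have e1 : (1 + s) ^ (-a - 1) = (P * (1 + s))⁻¹ := by
    rw [show -a - 1 = -(a + 1) by ring, Real.rpow_neg hs1.le, Real.rpow_add_one hs1.ne']
  have e2 : (1 + s) ^ (-a - 2) = (P * (1 + s) ^ 2)⁻¹ := by
    rw [show -a - 2 = -(a + (2 : ℕ)) by push_cast; ring, Real.rpow_neg hs1.le,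
      Real.rpow_add_natCast hs1.ne']
  have e3 : (1 + s) ^ d = P ^ 2 * (1 + s) := by
    rw [show d = a + a + 1 by rw [ha_def]; ring, Real.rpow_add_one hs1.ne',
      Real.rpow_add hs1, pow_two]
  rw [e1] at hx2 hx3
  rw [e2] at hx2
  -- the term with the gradient is absorbed
  have h1 : a * (a + 1) * (P * (1 + s) ^ 2)⁻¹ * N * a ≤ (a + 1) * P * η := by
    have : a * (a + 1) * (P * (1 + s) ^ 2)⁻¹ * N * a
        = (a + 1) * P * ((a * (P * (1 + s))⁻¹) ^ 2 * N) := by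
      field_simp
    rw [this]
    exact mul_le_mul_of_nonneg_left hx3 (by positivity)
  have h2 : a * (P * (1 + s))⁻¹ * (c₀ * s ^ d) ≤ a * (P * (1 + s))⁻¹ * S.subLaplacian u x :=
    mul_le_mul_of_nonneg_left (hineq x) (by positivity)
  have h3 : a * (a * (P * (1 + s))⁻¹ * (c₀ * s ^ d)) ≤ P * (η * (2 * a + 1)) := by
    have h4 : a * (P * (1 + s))⁻¹ * (c₀ * s ^ d)
        ≤ η + a * (a + 1) * (P * (1 + s) ^ 2)⁻¹ * N := by linarith
    have h5 := mul_le_mul_of_nonneg_left h4 ha.le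
    -- `a η ≤ a P η` because `P ≥ 1`, so both errors are multiples of `P η`.
    nlinarith [mul_nonneg (mul_nonneg ha.le hη.le) (sub_nonneg.2 hP1)]
  have h6 : a * (a * (P * (1 + s))⁻¹ * (c₀ * s ^ d)) = P * (a ^ 2 * c₀ * (s / (1 + s)) ^ d) := by
    rw [Real.div_rpow hs0 hs1.le, e3]
    field_simp
  rw [h6] at h3
  have h7 := le_of_mul_le_mul_left h3 hP0
  -- `s ↦ s/(1 + s)` is increasing, which gives a bound uniform in the unknown value `s`.
  have h8 : (δ / (1 + δ)) ^ d ≤ (s / (1 + s)) ^ d := by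
    refine Real.rpow_le_rpow (by positivity) ?_ (by linarith)
    rw [div_le_div_iff₀ (by linarith) hs1]
    linarith
  have h9 : q ≤ a ^ 2 * c₀ * (s / (1 + s)) ^ d := mul_le_mul_of_nonneg_left h8 (by positivity)
  linarith

end PseudoHermitianGeometry.PseudoHermitian

/-! ### The three ranges of the exponent -/

theorem corollary5p4 {m : ℕ} {M : Type*} [TopologicalSpace M] [T2Space M]
    [SecondCountableTopology M] [Nonempty M] [ChartedSpace (PseudoHermitianGeometry.Model m) M]
    [IsManifold 𝓘(ℝ, PseudoHermitianGeometry.Model m) ∞ M]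
    (S : PseudoHermitianGeometry.PseudoHermitian m M)
    -- the exhaustion function `γ`
    (γ : M → ℝ)
    (hγ : ContMDiff 𝓘(ℝ, PseudoHermitianGeometry.Model m) 𝓘(ℝ) 2 γ)
    (hγ_nonneg : ∀ x, 0 ≤ γ x)
    (hγ_lim : ∀ η : ℝ, 0 < η → ∃ K : Set M, IsCompact K ∧ ∀ x ∉ K, η < γ x)
    (A B : ℝ) (hA : 0 < A) (hB : 0 < B)
    (hγ_grad : ∃ K : Set M, IsCompact K ∧
      ∀ x ∉ K, S.websterNorm x (S.horizontalGradient γ x) ≤ A * √(γ x))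
    -- the function `G` on `[0, ∞)`
    (G : ℝ → ℝ) (hG : ContDiffOn ℝ ∞ G (Ici 0))
    (hG_zero : 0 < G 0)
    (hG_deriv : ∀ t : ℝ, 0 ≤ t → 0 ≤ derivWithin G (Ici 0) t)
    (hG_int : ¬ IntegrableAtFilter (fun t : ℝ => G t ^ (-(1 / 2) : ℝ)) atTop volume)
    (hG_limsup : ∃ C : ℝ, ∀ᶠ t : ℝ in atTop, t * G (√t) / G t ≤ C)
    (hγ_lap : ∃ K : Set M, IsCompact K ∧
      ∀ x ∉ K, S.subLaplacian γ x ≤ B * √(γ x) * √(G (√(γ x))))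
    -- the differential inequality
    (u : M → ℝ)
    (hu : ContMDiff 𝓘(ℝ, PseudoHermitianGeometry.Model m) 𝓘(ℝ) 2 u)
    (c₀ d : ℝ) (hc₀ : 0 < c₀) (hd : 0 ≤ d)
    (hineq : ∀ x, c₀ * u x ^ d ≤ S.subLaplacian u x) :
    ((∀ x, 0 ≤ u x) → 1 < d → ∀ x, u x = 0) ∧
    ((∀ x, 0 ≤ u x) → BddAbove (range u) → 0 < d → d ≤ 1 → ∀ x, u x = 0) ∧
    (d = 0 → ¬ BddAbove (range u)) :=  by
  obtain ⟨h, hh, hlim, C, hgrad, hlap⟩ := S.exists_proper_function γ hγ hγ_lim A B hB hγ_grad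
    G hG hG_zero hG_deriv hG_int hG_limsup hγ_lap
  refine ⟨fun hpos h1 p => S.eq_zero_of_superlinear hh hlim hgrad hlap hu hc₀ h1 hineq hpos p,
    fun hpos hbdd hd0 _ p => ?_, fun hd0 hbdd => ?_⟩
  · by_contra hne
    have hp : 0 < u p := lt_of_le_of_ne (hpos p) (Ne.symm hne)
    have hq : 0 < c₀ * (u p / 2) ^ d := by positivity
    -- `η < u p / 2` keeps `u x ≥ u p / 2` at the almost maximal point, so there `Δ_b u ≥ c₀ (u p /
    -- 2)^d > η`.
    obtain ⟨η, hη, hη1⟩ := exists_between (lt_min (half_pos hp) hq)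
    obtain ⟨x, hx1, hx2, -⟩ := S.exists_almost_max hh hlim hgrad hlap hu hbdd p hη
    have h1 := hη1.trans_le (min_le_left _ _)
    have h2 : (u p / 2) ^ d ≤ u x ^ d := Real.rpow_le_rpow (by positivity) (by linarith) hd
    have h3 := mul_le_mul_of_nonneg_left h2 hc₀.le
    linarith [hη1.trans_le (min_le_right _ _), hineq x]
  · obtain ⟨p⟩ := ‹Nonempty M›
    obtain ⟨x, -, hx, -⟩ := S.exists_almost_max hh hlim hgrad hlap hu hbdd p (half_pos hc₀)
    have h1 := hineq x
    -- `Real.rpow_zero` holds for every base, so no sign of `u` is needed; `Δ_b u ≥ c₀` contradicts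
    -- `Δ_b u ≤ c₀ / 2`.
    rw [hd0, Real.rpow_zero, mul_one] at h1
    linarith
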